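/- **Model.** Jobs arrive in a Poisson process of rate $\lambda>0$ to a base queue. A local server has capacity $\mu_0>0$ and a cloud server has capacity $K\mu_0$ with $K>1$; let $1/K<f<1$ and put $\mu_{c1}=K\mu_0$, $\mu_{l2}=\mu_0/f$, $\mu_{c2}=K\mu_0/(1-f)$. A job of the base queue can be assigned to mode 1 (SM1: an exponential service of rate $\mu_{c1}$ at the cloud) or to mode 2 (SM2: an exponential service of rate $\mu_{l2}$ at the local server, followed by an independent exponential service of rate $\mu_{c2}$ at the cloud). The servers never idle when they have work, and the cloud gives SM2 jobs preemptive priority over SM1 jobs. The state is $s=(n_0,i_2,i_1,n_2)\in\mathcal S=\mathbb N_0\times\{0,1\}^2\times\mathbb N_0$: $n_0$ jobs in the base queue, $i_2$ SM2 jobs at the local server, $i_1$ SM1 jobs at the cloud, $n_2$ SM2 jobs at the cloud; $n(s)=n_0+i_2+i_1+n_2$. The action $\mathtt{idle}$ is always admissible, $\mathtt{SM1}$ is admissible iff $n_0\ge 1$ and $i_1=0$, and $\mathtt{SM2}$ is admissible iff $n_0\ge1$ and $i_2=0$. A policy $\pi$ assigns to each state an admissible action; at time $0$ and at every arrival and service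 completion the actions it prescribes are carried out instantaneously, in succession, until it prescribes $\mathtt{idle}$. Under $\pi$ the state is then a continuous-time Markov chain $s(t)$, with $n(t)=n(s(t))$. For $\beta>0$ let $$J_\beta(s_0;\pi)=\mathbb E_\pi\Big[\int_0^\infty e^{-\beta t}n(t)\,dt\;\Big|\;s(0)=s_0\Big],\qquad V_\beta(s_0)=\inf_\pi J_\beta(s_0;\pi).$$ A policy $\pi^*$ is *delay-optimal* if $J_\beta(s_0;\pi^*)=V_\beta(s_0)$ for all $s_0\in\mathcal S$. It is *cloud-first* if $\pi^*(n_0,i_2,0,0)=\mathtt{SM1}$ for all $n_0\ge1$ and $i_2\in\{0,1\}$. It is *switch-type* if for all $s\in\mathcal S$ and $(x_0,x_2)\in\mathbb N_0^2$ $$\pi^*(s)=\mathtt{SM2}\ \Rightarrow\ \pi^*(s+(x_0,0,0,x_2))=\mathtt{SM2}.$$ Let $As=s+(1,0,0,0)$. **Theorem (Switch-Type Structure).** Assume $\lambda<(K+1)\mu_0$ (the stability region). Let $\pi^*$ be a delay-optimal, cloud-first policy that satisfies urgency-monotonicity: for all $s\in\mathcal S$, $\pi^*(As)=\mathtt{idle}\Rightarrow\pi^*(s)=\mathtt{idle}$.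 Then $\pi^*$ is switch-type. Moreover, there are non-increasing sequences of non-negative integers $(N_k)_{k\ge0}$ and $(N'_k)_{k\ge1}$ such that for all $n_0\ge0$ $$\pi^*(n_0,0,1,k)=\begin{cases}\mathtt{SM2}&n_0\ge N_k\\ \mathtt{idle}&n_0<N_k\end{cases}\quad(k\ge0),\qquad \pi^*(n_0,0,0,k)=\begin{cases}\mathtt{SM2}&n_0\ge N'_k\\ \mathtt{idle}&n_0<N'_k\end{cases}\quad(k\ge1).$$ -/

import Mathlib

open MeasureTheory ProbabilityTheory

open scoped ENNReal

namespace Offloading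

noncomputable section

/-- Parameters of the two-server offloading system, together with the discount factor. -/
structure Params where
  /-- arrival rate of jobs -/
  lam : ℝ
  /-- processing capacity of the local server -/
  mu0 : ℝ
  /-- the cloud server has capacity `K * mu0` -/
  K : ℝ
  /-- fraction of the processing done locally in service mode 2 -/
  f : ℝ
  /-- discount factor -/
  beta : ℝ
  lam_pos : 0 < lam
  mu0_pos : 0 < mu0
  one_lt_K : 1 < K
  inv_K_lt_f : 1 / K < f
  f_lt_one : f < 1
  beta_pos : 0 < beta

/-- Service rate at the cloud of a service mode 1 job. -/
def Params.muC1 (M : Params) : ℝ := M.K * M.mu0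

/-- Service rate at the local server of a service mode 2 job. -/
def Params.muL2 (M : Params) : ℝ := M.mu0 / M.f

/-- Service rate at the cloud of a service mode 2 job. -/
def Params.muC2 (M : Params) : ℝ := M.K * M.mu0 / (1 - M.f)

/-- System state `(n0, i2, i1, n2)`. -/
@[ext] structure State where
  /-- number of jobs in the base queue -/
  n0 : ℕ
  /-- indicator of a service mode 2 job at the local server -/
  i2 : Fin 2
  /-- indicator of a service mode 1 job at the cloud (in queue or in service) -/
  i1 : Fin 2
  /-- number of service mode 2 jobs at the cloud -/
  n2 : ℕ

/-- Total number of jobs in the system. -/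
def State.jobs (s : State) : ℕ := s.n0 + (s.i2 : ℕ) + (s.i1 : ℕ) + s.n2

/-- Control actions of the mode selector. -/
inductive Action where
  | idle
  | SM1
  | SM2
  deriving DecidableEq

/-- The set of admissible control actions in a state. -/
def admissible (s : State) : Set Action :=
  {a | match a with
    | Action.idle => True
    | Action.SM1 => 1 ≤ s.n0 ∧ s.i1 = 0
    | Action.SM2 => 1 ≤ s.n0 ∧ s.i2 = 0}

/-- A stationary Markovian system policy. -/
structure Policy where
  /-- the control action prescribed in each state -/
  act : State → Action
  act_mem : ∀ s, act s ∈ admissible s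

instance : CoeFun Policy (fun _ => State → Action) := ⟨Policy.act⟩

/-- An arrival to the base queue. -/
def arrive (s : State) : State := { s with n0 := s.n0 + 1 }

/-- Instantaneous effect of an (admissible) control action on the state. -/
def assign (a : Action) (s : State) : State :=
  match a with
  | Action.idle => s
  | Action.SM1 => { s with n0 := s.n0 - 1, i1 := 1 }
  | Action.SM2 => { s with n0 := s.n0 - 1, i2 := 1 }

/-- The state right after a decision instant: the policy picks control actions in immediate
succession until it idles. At most two assignments are admissible in succession, since each of
the two modes has room for a single newly assigned job. -/
def settle (p : Policy) (s : State) : State :=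
  let s' := assign (p s) s
  assign (p s') s'

theorem settle_idle (p : Policy) (s : State) : p (settle p s) = Action.idle := by
  have key : ∀ s : State, s.i1 = 1 → s.i2 = 1 → p s = Action.idle := by
    intro s h1 h2
    have := p.act_mem s
    cases h : p.act s <;> simp_all [admissible]
  have h1 := p.act_mem s
  unfold settle
  cases h : p.act s
  · simp [assign, h]
  all_goals
    rw [h] at h1
    simp only [assign]
    generalize hs' : State.mk _ _ _ _ = s'
    have h2 := p.act_mem s'
    cases h' : p.act s'
    · simpa using h'
    all_goals
      rw [h'] at h2
      subst hs'
      simp_all [admissible]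

/-- The kinds of events that drive the system: an arrival, and the ticks of the service clocks of
the local server, of the cloud for mode 1 jobs, and of the cloud for mode 2 jobs. -/
inductive Event where
  | arrival
  | tickL2
  | tickC1
  | tickC2
  deriving DecidableEq

instance : Fintype Event where
  elems := {Event.arrival, Event.tickL2, Event.tickC1, Event.tickC2}
  complete := by intro e; cases e <;> simp

instance : MeasurableSpace Event := ⊤

/-- Rate of each kind of event. -/
def Params.rate (M : Params) : Event → ℝ
  | Event.arrival => M.lam
  | Event.tickL2 => M.muL2
  | Event.tickC1 => M.muC1
  | Event.tickC2 => M.muC2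

/-- Effect of an event on the state. A tick of a service clock completes the service of the job
currently served at that rate, if there is one, and changes nothing otherwise. The cloud gives
mode 2 jobs (preemptive) priority over the mode 1 job. -/
def react (e : Event) (s : State) : State :=
  match e with
  | Event.arrival => arrive s
  | Event.tickL2 => if s.i2 = 1 then { s with i2 := 0, n2 := s.n2 + 1 } else s
  | Event.tickC1 => if s.i1 = 1 ∧ s.n2 = 0 then { s with i1 := 0 } else s
  | Event.tickC2 => if 1 ≤ s.n2 then { s with n2 := s.n2 - 1 } else s

theorem Params.rate_pos (M : Params) (e : Event) : 0 < M.rate e := by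
  have hm := M.mu0_pos
  have hK : 0 < M.K := by linarith [M.one_lt_K]
  have hf : 0 < M.f := lt_trans (by positivity) M.inv_K_lt_f
  have hf' : 0 < 1 - M.f := by linarith [M.f_lt_one]
  have hl := M.lam_pos
  cases e <;> simp only [Params.rate, Params.muL2, Params.muC1, Params.muC2] <;> positivity

/-- Total rate of all events. -/
def Params.totalRate (M : Params) : ℝ := ∑ e, M.rate e

theorem Params.totalRate_pos (M : Params) : 0 < M.totalRate :=
  Finset.sum_pos (fun e _ => M.rate_pos e) ⟨Event.arrival, Finset.mem_univ _⟩

/-- The law of the kind of an event: kind `e` has probability `rate e / totalRate`. -/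
def Params.eventLaw (M : Params) : PMF Event :=
  PMF.ofFintype (fun e => ENNReal.ofReal (M.rate e / M.totalRate)) (by
    rw [← ENNReal.ofReal_sum_of_nonneg
      (fun e _ => div_nonneg (M.rate_pos e).le M.totalRate_pos.le), ← Finset.sum_div]
    have h : (∑ e, M.rate e) / M.totalRate = 1 := div_self M.totalRate_pos.ne'
    rw [h, ENNReal.ofReal_one])

/-- The law of one (time since the previous event, kind of the event) pair. -/
def Params.stepLaw (M : Params) : Measure (ℝ × Event) :=
  (expMeasure M.totalRate).prod M.eventLaw.toMeasure

instance (M : Params) : IsProbabilityMeasure M.stepLaw := by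
  have := isProbabilityMeasure_expMeasure M.totalRate_pos
  unfold Params.stepLaw
  infer_instance

/-- Sample points: sequences of (time since the previous event, kind of the event). -/
abbrev Sample := ℕ → ℝ × Event

/-- Independent exponential gaps of rate `totalRate` with independent marks: equivalently, the
four kinds of events occur along independent Poisson processes of the rates `rate e`. -/
def Params.law (M : Params) : Measure Sample :=
  Measure.infinitePi (fun _ : ℕ => M.stepLaw)

/-- The time of the `m`-th event (with `eventTime w 0 = 0`). -/
def eventTime (w : Sample) (m : ℕ) : ℝ := ∑ i ∈ Finset.range m, (w i).1

/-- The number of events in the time interval `(0, t]`. -/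
def eventCount (w : Sample) (t : ℝ) : ℕ := {m : ℕ | eventTime w (m + 1) ≤ t}.ncard

/-- The state right after the `m`-th event and the control actions taken at that instant, under
policy `p` and with initial state `s0`. -/
def stateAfter (p : Policy) (s0 : State) (w : Sample) : ℕ → State
  | 0 => settle p s0
  | m + 1 => settle p (react (w m).2 (stateAfter p s0 w m))

/-- The state `s(t)` at time `t`, under policy `p` and with `s(0) = s0`. -/
def stateAt (p : Policy) (s0 : State) (w : Sample) (t : ℝ) : State :=
  stateAfter p s0 w (eventCount w t)

/-- The discounted cost-to-go: the expectation of `∫_0^∞ exp (-β t) n(t) dt`. -/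
def Params.cost (M : Params) (s0 : State) (p : Policy) : ℝ≥0∞ :=
  ∫⁻ w, (∫⁻ t in Set.Ici (0 : ℝ),
    ENNReal.ofReal (Real.exp (-M.beta * t)) * ((stateAt p s0 w t).jobs : ℝ≥0∞)) ∂M.law

/-- The value function. -/
def Params.value (M : Params) (s0 : State) : ℝ≥0∞ := ⨅ p : Policy, M.cost s0 p

/-- Delay optimality: the policy attains the value function at every initial state. -/
def Params.DelayOptimal (M : Params) (p : Policy) : Prop := ∀ s0, M.cost s0 p = M.value s0

/-- A cloud-first policy assigns SM1 whenever the base queue is nonempty and the cloud is empty. -/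
def CloudFirst (p : Policy) : Prop :=
  ∀ s : State, 1 ≤ s.n0 → s.i1 = 0 → s.n2 = 0 → p s = Action.SM1

/-- The urgency-monotonicity property of a policy. -/
def UrgencyMonotone (p : Policy) : Prop :=
  ∀ s : State, p (arrive s) = Action.idle → p s = Action.idle

/-- A switch-type policy keeps assigning SM2 when jobs are added to the base queue or to the SM2
cloud queue. -/
def SwitchType (p : Policy) : Prop :=
  ∀ (s : State) (x0 x2 : ℕ), p s = Action.SM2 →
    p { s with n0 := s.n0 + x0, n2 := s.n2 + x2 } = Action.SM2

end

end Offloading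

namespace Offloading

/-! Splitting off the first event shows that the cost-to-go `V` of an optimal policy satisfies the
dynamic programming relations `OptimalityEq`; everything after that uses only these. Differences of
`V` are compared by coupling two states event by event. Discounting contracts the bounds, and the
linear growth of `V` lets `nonpos_of_discounted_step` conclude.

Monotonicity in the base queue is urgency-monotonicity, once SM1 is excluded. Monotonicity in the
mode 2 cloud queue is `sm2_of_sm2_optimal`. Let `D j ≥ 0` be the loss from choosing SM2 with `j`
extra jobs in the base queue. If the policy idles there, the next event gives `(b + a + c2) * D j <
a * D (j + 1)`, strictly because finishing the local phase is a strict gain (`local_done_lt`). So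
SM2 cannot be prescribed one job later; idling persists, and `D` grows geometrically, against linear
growth.

With a mode 1 job at the cloud SM1 is inadmissible and this suffices. With none, but mode 2 jobs
present, SM1 is excluded by `sm1_lt`. If it were optimal, sending and queueing would tie in value;
ties propagate to arbitrarily many mode 2 jobs (`tie_succ`). There SM2 is chosen for every nonempty
base queue (`exists_forall_sm2`), which moves the tie down to an empty queue, against
`exists_forall_single_lt`.

Thresholds are finite by `exists_sm2`: perpetual idling would make the loss of SM2 negative for long
queues. -/

instance : MeasurableSpace State := ⊤

instance : DiscreteMeasurableSpace State := ⟨fun _ => trivial⟩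

instance : Countable State := by
  have : Function.Injective (fun s : State => (s.n0, s.i2, s.i1, s.n2)) := by
    intro s t h
    simp only [Prod.mk.injEq] at h
    exact State.ext h.1 h.2.1 h.2.2.1 h.2.2.2
  exact this.countable

instance : DiscreteMeasurableSpace Event := ⟨fun _ => trivial⟩

instance : Countable Event := Finite.to_countable

/-! ### Splitting off the first event -/

instance (M : Params) : IsProbabilityMeasure M.law := by
  unfold Params.law
  infer_instance

/-- Prepending one (gap, kind) pair to a sample point. -/
def consSample (x : (ℝ × Event) × Sample) : Sample := fun n => Nat.casesOn n x.1 x.2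

@[simp] theorem consSample_zero (x : (ℝ × Event) × Sample) : consSample x 0 = x.1 := rfl

@[simp] theorem consSample_succ (x : (ℝ × Event) × Sample) (n : ℕ) :
    consSample x (n + 1) = x.2 n := rfl

theorem measurable_consSample : Measurable consSample := by
  refine measurable_pi_lambda _ fun n => ?_
  cases n with
  | zero => exact measurable_fst
  | succ n => exact (measurable_pi_apply n).comp measurable_snd

/-- An i.i.d. sequence with an independent copy of its entries put in front has the same law. It
suffices to compare finite-dimensional boxes, where both sides are the same product up to an index
shift. -/
theorem map_consSample (M : Params) :
    (M.stepLaw.prod M.law).map consSample = M.law := by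
  refine Measure.eq_infinitePi (fun _ : ℕ => M.stepLaw) ?_
  intro I t ht
  classical
  rw [Measure.map_apply measurable_consSample
    (MeasurableSet.pi I.countable_toSet fun i _ => ht i)]
  set J : Finset ℕ := (Finset.range (I.sup id + 1)) with hJ
  set t' : ℕ → Set (ℝ × Event) := fun i => if i ∈ I then t i else Set.univ with ht'
  have hpre : consSample ⁻¹' (Set.pi I t) =
      (t' 0) ×ˢ (Set.pi (J : Set ℕ) fun i => t' (i + 1)) := by
    ext x
    simp only [Set.mem_preimage, Set.mem_pi, Finset.mem_coe, Set.mem_prod, ht']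
    constructor
    · intro h
      refine ⟨?_, fun i _ => ?_⟩
      · by_cases h0 : 0 ∈ I
        · simpa [h0] using h 0 h0
        · simp [h0]
      · by_cases h0 : i + 1 ∈ I
        · simpa [h0] using h (i + 1) h0
        · simp [h0]
    · rintro ⟨h0, h1⟩ i hi
      cases i with
      | zero => simpa [hi] using h0
      | succ i =>
        have : i ∈ J := by
          have : i + 1 ≤ I.sup id := Finset.le_sup (f := id) hi
          simp [hJ]; omega
        simpa [hi] using h1 i this
  rw [hpre, Measure.prod_prod]
  unfold Params.law
  rw [Measure.infinitePi_pi (fun _ : ℕ => M.stepLaw)]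
  · have h2 : ∏ i ∈ I, M.stepLaw (t i) = ∏ i ∈ Finset.range (I.sup id + 2), M.stepLaw (t' i) := by
      have hsub : I ⊆ Finset.range (I.sup id + 2) := by
        intro i hi
        have : i ≤ I.sup id := Finset.le_sup (f := id) hi
        simp; omega
      rw [← Finset.prod_subset hsub]
      · exact Finset.prod_congr rfl fun i hi => by simp [ht', hi]
      · intro i _ hi
        simp [ht', hi]
    rw [h2]
    rw [Finset.prod_range_succ' (fun i => M.stepLaw (t' i)) (I.sup id + 1)]
    exact mul_comm _ _
  · intro i _
    simp only [ht']
    split_ifs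
    · exact ht _
    · exact MeasurableSet.univ

theorem lintegral_law (M : Params) {F : Sample → ℝ≥0∞} (hF : Measurable F) :
    ∫⁻ w, F w ∂M.law = ∫⁻ x, ∫⁻ w, F (consSample (x, w)) ∂M.law ∂M.stepLaw := by
  conv_lhs => rw [← map_consSample M]
  rw [lintegral_map hF measurable_consSample]
  exact lintegral_prod _ (hF.comp measurable_consSample).aemeasurable

theorem eventTime_consSample (x : (ℝ × Event) × Sample) (m : ℕ) :
    eventTime (consSample x) (m + 1) = x.1.1 + eventTime x.2 m := by
  unfold eventTime
  rw [Finset.sum_range_succ', add_comm]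
  simp

theorem stateAfter_consSample (p : Policy) (s : State) (x : (ℝ × Event) × Sample) (m : ℕ) :
    stateAfter p s (consSample x) (m + 1) = stateAfter p (react x.1.2 (settle p s)) x.2 m := by
  induction m with
  | zero => rfl
  | succ m ih =>
    rw [stateAfter, ih]
    rfl

theorem measurable_eventTime (m : ℕ) : Measurable (fun w : Sample => eventTime w m) := by
  unfold eventTime
  fun_prop

theorem measurable_stateAfter (p : Policy) (s : State) (m : ℕ) :
    Measurable (fun w : Sample => stateAfter p s w m) := by
  induction m with
  | zero => exact measurable_const
  | succ m ih =>
    have h : Measurable (fun x : Event × State => settle p (react x.1 x.2)) :=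
      measurable_of_countable _
    exact h.comp ((measurable_snd.comp (measurable_pi_apply m)).prodMk ih)

/-! ### Integrals against the exponential gap -/

/-- Laplace transform of the exponential law. -/
theorem lintegral_exp_expMeasure {r b : ℝ} (hr : 0 < r) (hb : 0 < b) :
    ∫⁻ x, ENNReal.ofReal (Real.exp (-b * x)) ∂(expMeasure r) = ENNReal.ofReal (r / (b + r)) := by
  have hm : Measurable (exponentialPDF r) :=
    (measurable_exponentialPDFReal r).ennreal_ofReal
  have hm' : Measurable (exponentialPDF (b + r)) :=
    (measurable_exponentialPDFReal (b + r)).ennreal_ofReal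
  have he : expMeasure r = volume.withDensity (exponentialPDF r) := rfl
  rw [he, lintegral_withDensity_eq_lintegral_mul _ hm (by fun_prop)]
  have : ∀ x, (exponentialPDF r * fun x => ENNReal.ofReal (Real.exp (-b * x))) x
      = ENNReal.ofReal (r / (b + r)) * exponentialPDF (b + r) x := by
    intro x
    rcases lt_or_ge x 0 with hx | hx
    · simp [exponentialPDF_of_neg hx]
    · rw [Pi.mul_apply, exponentialPDF_of_nonneg hx, exponentialPDF_of_nonneg hx,
        ← ENNReal.ofReal_mul (by positivity), ← ENNReal.ofReal_mul (by positivity)]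
      congr 1
      have : Real.exp (-((b + r) * x)) = Real.exp (-(r * x)) * Real.exp (-b * x) := by
        rw [← Real.exp_add]; congr 1; ring
      rw [this]
      field_simp
  simp_rw [this]
  rw [lintegral_const_mul _ hm', lintegral_exponentialPDF_eq_one (by positivity), mul_one]

theorem ae_nonneg_expMeasure (r : ℝ) : ∀ᵐ x ∂(expMeasure r), 0 ≤ x := by
  have he : expMeasure r = volume.withDensity (exponentialPDF r) := rfl
  have hm : Measurable (exponentialPDF r) :=
    (measurable_exponentialPDFReal r).ennreal_ofReal
  rw [he, ae_withDensity_iff hm]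
  refine Filter.Eventually.of_forall fun x hx => ?_
  by_contra h
  exact hx (exponentialPDF_of_neg (not_le.mp h))

/-- The expected discounted length of one gap. On `0 ≤ x` the integrand and `exp (-b x) / b` add up
to the constant `1 / b`, so the Laplace transform gives the value. -/
theorem lintegral_one_sub_exp_expMeasure {r b : ℝ} (hr : 0 < r) (hb : 0 < b) :
    ∫⁻ x, ENNReal.ofReal ((1 - Real.exp (-b * x)) / b) ∂(expMeasure r)
      = ENNReal.ofReal (1 / (b + r)) := by
  have := isProbabilityMeasure_expMeasure hr
  have hsum : ∫⁻ x, ENNReal.ofReal ((1 - Real.exp (-b * x)) / b) ∂(expMeasure r)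
      + ∫⁻ x, ENNReal.ofReal (1 / b) * ENNReal.ofReal (Real.exp (-b * x)) ∂(expMeasure r)
      = ENNReal.ofReal (1 / b) := by
    rw [← lintegral_add_left (by fun_prop)]
    have : ∀ᵐ x ∂(expMeasure r), ENNReal.ofReal ((1 - Real.exp (-b * x)) / b)
        + ENNReal.ofReal (1 / b) * ENNReal.ofReal (Real.exp (-b * x))
        = ENNReal.ofReal (1 / b) := by
      filter_upwards [ae_nonneg_expMeasure r] with x hx
      have h1 : Real.exp (-b * x) ≤ 1 := Real.exp_le_one_iff.mpr (by nlinarith)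
      rw [← ENNReal.ofReal_mul (by positivity), ← ENNReal.ofReal_add
        (div_nonneg (by linarith) hb.le) (by positivity)]
      congr 1
      field_simp
      ring
    rw [lintegral_congr_ae this, lintegral_const, measure_univ, mul_one]
  rw [lintegral_const_mul _ (by fun_prop), lintegral_exp_expMeasure hr hb,
    ← ENNReal.ofReal_mul (by positivity)] at hsum
  have hs2 : ENNReal.ofReal (1 / b) = ENNReal.ofReal (1 / (b + r))
      + ENNReal.ofReal (1 / b * (r / (b + r))) := by
    rw [← ENNReal.ofReal_add (by positivity) (by positivity)]
    congr 1
    field_simp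
  rw [hs2] at hsum
  exact (ENNReal.add_left_inj ENNReal.ofReal_ne_top).mp hsum

/-! ### Discounted expectations at event times -/

theorem lintegral_eventLaw (M : Params) (f : Event → ℝ≥0∞) :
    ∫⁻ e, f e ∂M.eventLaw.toMeasure
      = ∑ e, ENNReal.ofReal (M.rate e / M.totalRate) * f e := by
  rw [lintegral_fintype]
  refine Finset.sum_congr rfl fun e _ => ?_
  rw [PMF.toMeasure_apply_singleton _ _ (measurableSet_singleton e), mul_comm]
  rfl

/-- Expectation of `exp (-b T_m) φ(X_m) ψ(g_m)`, with `T_m` the time of the `m`-th event, `X_m` the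
state after it and `g_m` the gap that follows. -/
noncomputable def discMoment (M : Params) (b : ℝ) (p : Policy) (φ : State → ℝ≥0∞) (ψ : ℝ → ℝ≥0∞)
    (m : ℕ) (s : State) : ℝ≥0∞ :=
  ∫⁻ w, ENNReal.ofReal (Real.exp (-b * eventTime w m)) * φ (stateAfter p s w m) * ψ (w m).1 ∂M.law

theorem measurable_discMoment_integrand (b : ℝ) (p : Policy) (φ : State → ℝ≥0∞)
    {ψ : ℝ → ℝ≥0∞} (hψ : Measurable ψ) (m : ℕ) (s : State) :
    Measurable fun w : Sample => ENNReal.ofReal (Real.exp (-b * eventTime w m)) *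
      φ (stateAfter p s w m) * ψ (w m).1 := by
  have h1 := measurable_eventTime m
  have h2 : Measurable fun w : Sample => φ (stateAfter p s w m) :=
    (measurable_of_countable φ).comp (measurable_stateAfter p s m)
  have h3 : Measurable fun w : Sample => ψ (w m).1 :=
    hψ.comp (measurable_fst.comp (measurable_pi_apply m))
  exact ((h1.const_mul (-b)).exp.ennreal_ofReal.mul h2).mul h3

theorem discMoment_zero (M : Params) (b : ℝ) (p : Policy) (φ : State → ℝ≥0∞)
    {ψ : ℝ → ℝ≥0∞} (hψ : Measurable ψ) (s : State) :
    discMoment M b p φ ψ 0 s = φ (settle p s) * ∫⁻ x, ψ x ∂(expMeasure M.totalRate) := by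
  have := isProbabilityMeasure_expMeasure M.totalRate_pos
  unfold discMoment
  rw [lintegral_law M (measurable_discMoment_integrand b p φ hψ 0 s)]
  simp only [eventTime, Finset.range_zero, Finset.sum_empty, mul_zero, Real.exp_zero,
    ENNReal.ofReal_one, one_mul, stateAfter, consSample_zero, lintegral_const, measure_univ,
    mul_one]
  have hm : Measurable fun x : ℝ × Event => ψ x.1 := hψ.comp measurable_fst
  rw [lintegral_const_mul _ hm]
  congr 1
  unfold Params.stepLaw
  rw [lintegral_prod _ hm.aemeasurable]
  simp

/-- Markov property at the first event. The discount over the first gap integrates to `R / (b + R)`,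
with `R` the total rate, and the independent mark has probability `rate e / R`, so `R` cancels. -/
theorem discMoment_succ (M : Params) {b : ℝ} (hb : 0 < b) (p : Policy) (φ : State → ℝ≥0∞)
    {ψ : ℝ → ℝ≥0∞} (hψ : Measurable ψ) (m : ℕ) (s : State) :
    discMoment M b p φ ψ (m + 1) s = ∑ e, ENNReal.ofReal (M.rate e / (b + M.totalRate)) *
      discMoment M b p φ ψ m (react e (settle p s)) := by
  have hR := M.totalRate_pos
  conv_lhs => unfold discMoment
  rw [lintegral_law M (measurable_discMoment_integrand b p φ hψ (m + 1) s)]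
  have hin : ∀ x : ℝ × Event, ∫⁻ w, ENNReal.ofReal (Real.exp (-b *
      eventTime (consSample (x, w)) (m + 1))) * φ (stateAfter p s (consSample (x, w)) (m + 1)) *
      ψ (consSample (x, w) (m + 1)).1 ∂M.law
      = ENNReal.ofReal (Real.exp (-b * x.1)) *
        discMoment M b p φ ψ m (react x.2 (settle p s)) := by
    intro x
    unfold discMoment
    rw [← lintegral_const_mul _ (measurable_discMoment_integrand b p φ hψ m _)]
    refine lintegral_congr fun w => ?_
    rw [eventTime_consSample, stateAfter_consSample, mul_add, Real.exp_add,
      ENNReal.ofReal_mul (Real.exp_pos _).le, consSample_succ]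
    ring
  simp_rw [hin]
  unfold Params.stepLaw
  have hmeas : Measurable fun x : ℝ × Event => ENNReal.ofReal (Real.exp (-b * x.1)) *
      discMoment M b p φ ψ m (react x.2 (settle p s)) := by
    have : Measurable fun x : ℝ × Event => discMoment M b p φ ψ m (react x.2 (settle p s)) :=
      (measurable_of_countable
        (fun e : Event => discMoment M b p φ ψ m (react e (settle p s)))).comp measurable_snd
    fun_prop
  rw [lintegral_prod _ hmeas.aemeasurable]
  simp only
  have hin2 : ∀ x : ℝ, ∫⁻ e, ENNReal.ofReal (Real.exp (-b * x)) *
      discMoment M b p φ ψ m (react e (settle p s)) ∂M.eventLaw.toMeasure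
      = ENNReal.ofReal (Real.exp (-b * x)) * ∑ e, ENNReal.ofReal (M.rate e / M.totalRate) *
        discMoment M b p φ ψ m (react e (settle p s)) := by
    intro x
    rw [lintegral_const_mul _ (measurable_of_countable _), lintegral_eventLaw]
  simp_rw [hin2]
  rw [lintegral_mul_const _ (by fun_prop), lintegral_exp_expMeasure hR hb, Finset.mul_sum]
  refine Finset.sum_congr rfl fun e _ => ?_
  rw [← mul_assoc, ← ENNReal.ofReal_mul (by positivity)]
  congr 2
  field_simp

theorem discMoment_one_one (M : Params) (p : Policy) (m : ℕ) (s : State) :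
    discMoment M 1 p 1 1 m s = ENNReal.ofReal (M.totalRate / (1 + M.totalRate)) ^ m := by
  have hR := M.totalRate_pos
  have := isProbabilityMeasure_expMeasure hR
  induction m generalizing s with
  | zero => simp [discMoment_zero M 1 p 1 (measurable_one : Measurable (1 : ℝ → ℝ≥0∞))]
  | succ m ih =>
    rw [discMoment_succ M one_pos p 1 (measurable_one : Measurable (1 : ℝ → ℝ≥0∞))]
    simp_rw [ih]
    rw [← Finset.sum_mul, ← ENNReal.ofReal_sum_of_nonneg
      (fun e _ => div_nonneg (M.rate_pos e).le (by positivity)), ← Finset.sum_div, pow_succ,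
      mul_comm]
    rfl

/-! ### Non-explosion and the path cost as a series -/

/-- The expectations of `exp (-T_m)` form a convergent geometric series, so almost surely the terms
`exp (-T_m)` are summable and tend to zero. The policy and the initial state are dummies. -/
theorem ae_tendsto_eventTime (M : Params) :
    ∀ᵐ w ∂M.law, Filter.Tendsto (eventTime w) Filter.atTop Filter.atTop := by
  have hR := M.totalRate_pos
  let p : Policy := ⟨fun _ => Action.idle, fun _ => trivial⟩
  let s : State := ⟨0, 0, 0, 0⟩
  have hm : ∀ m : ℕ, Measurable fun w : Sample => ENNReal.ofReal (Real.exp (-1 * eventTime w m)) :=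
    fun m => ((measurable_eventTime m).const_mul (-1)).exp.ennreal_ofReal
  have h1 : ∀ m : ℕ, ∫⁻ w, ENNReal.ofReal (Real.exp (-1 * eventTime w m)) ∂M.law
      = ENNReal.ofReal (M.totalRate / (1 + M.totalRate)) ^ m := by
    intro m
    rw [← discMoment_one_one M p m s]
    simp [discMoment]
  have h2 : ∫⁻ w, ∑' m, ENNReal.ofReal (Real.exp (-1 * eventTime w m)) ∂M.law ≠ ∞ := by
    rw [lintegral_tsum fun m => (hm m).aemeasurable]
    simp_rw [h1]
    rw [ENNReal.tsum_geometric]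
    have : ENNReal.ofReal (M.totalRate / (1 + M.totalRate)) < 1 := by
      rw [ENNReal.ofReal_lt_one, div_lt_one (by positivity)]
      linarith
    simpa [tsub_eq_zero_iff_le] using this
  filter_upwards [ae_lt_top (Measurable.tsum hm) h2] with w hw
  have h3 := ENNReal.tendsto_atTop_zero_of_tsum_ne_top hw.ne
  have h4 : Filter.Tendsto (fun m => Real.exp (-1 * eventTime w m)) Filter.atTop (nhds 0) := by
    have := (ENNReal.tendsto_toReal ENNReal.zero_ne_top).comp h3
    simpa [Function.comp_def, ENNReal.toReal_ofReal (Real.exp_pos _).le] using this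
  have h5 := Real.tendsto_exp_comp_nhds_zero.mp h4
  simpa using Filter.tendsto_neg_atBot_iff.mp (by simpa using h5)

theorem ae_gap_nonneg (M : Params) : ∀ᵐ w ∂M.law, ∀ i, 0 ≤ (w i).1 := by
  have := isProbabilityMeasure_expMeasure M.totalRate_pos
  rw [ae_all_iff]
  intro i
  have h1 : ∀ᵐ x ∂M.stepLaw, 0 ≤ x.1 := by
    have hq : Measure.QuasiMeasurePreserving (Prod.fst : ℝ × Event → ℝ) M.stepLaw
        (expMeasure M.totalRate) := Measure.quasiMeasurePreserving_fst
    exact hq.ae (ae_nonneg_expMeasure _)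
  exact (measurePreserving_eval_infinitePi (fun _ : ℕ => M.stepLaw) i).quasiMeasurePreserving.ae h1

theorem eventTime_mono {w : Sample} (hw : ∀ i, 0 ≤ (w i).1) : Monotone (eventTime w) := by
  refine monotone_nat_of_le_succ fun m => ?_
  unfold eventTime
  rw [Finset.sum_range_succ]
  linarith [hw m]

theorem eventCount_eq {w : Sample} (hw : ∀ i, 0 ≤ (w i).1) {m : ℕ} {t : ℝ}
    (ht : t ∈ Set.Ico (eventTime w m) (eventTime w (m + 1))) : eventCount w t = m := by
  have : {j : ℕ | eventTime w (j + 1) ≤ t} = (Finset.range m : Set ℕ) := by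
    ext j
    simp only [Set.mem_ofPred_eq, Finset.coe_range, Set.mem_Iio]
    constructor
    · intro h
      by_contra hj
      have := eventTime_mono hw (show m + 1 ≤ j + 1 by omega)
      linarith [ht.2]
    · intro h
      exact (eventTime_mono hw (show j + 1 ≤ m by omega)).trans ht.1
  rw [eventCount, this, Set.ncard_coe_finset, Finset.card_range]

theorem lintegral_exp_Ico {b a c : ℝ} (hb : 0 < b) (hac : a ≤ c) :
    ∫⁻ t in Set.Ico a c, ENNReal.ofReal (Real.exp (-b * t))
      = ENNReal.ofReal (Real.exp (-b * a)) * ENNReal.ofReal ((1 - Real.exp (-b * (c - a))) / b) := by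
  have hint : IntervalIntegrable (fun t => Real.exp (-b * t)) volume a c :=
    (by fun_prop : Continuous fun t => Real.exp (-b * t)).intervalIntegrable _ _
  rw [restrict_Ico_eq_restrict_Ioc, ← ofReal_integral_eq_lintegral_ofReal
    ((intervalIntegrable_iff_integrableOn_Ioc_of_le hac).mp hint)
    (Filter.Eventually.of_forall fun t => (Real.exp_pos _).le),
    ← intervalIntegral.integral_of_le hac, ← ENNReal.ofReal_mul (Real.exp_pos _).le]
  congr 1
  have hd : ∀ t ∈ Set.uIcc a c,
      HasDerivAt (fun t => -(Real.exp (-b * t)) / b) (Real.exp (-b * t)) t := by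
    intro t _
    have h : HasDerivAt (fun t : ℝ => -b * t) (-b) t := by
      simpa using (hasDerivAt_id t).const_mul (-b)
    have h2 := h.exp.neg.div_const b
    rwa [mul_neg, neg_neg, mul_div_cancel_right₀ _ hb.ne'] at h2
  rw [intervalIntegral.integral_eq_sub_of_hasDerivAt hd hint]
  have : Real.exp (-b * c) = Real.exp (-b * a) * Real.exp (-b * (c - a)) := by
    rw [← Real.exp_add]; congr 1; ring
  rw [this]
  field_simp
  ring

theorem iUnion_Ico_eventTime {w : Sample} (hw : ∀ i, 0 ≤ (w i).1)
    (hT : Filter.Tendsto (eventTime w) Filter.atTop Filter.atTop) :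
    Set.Ici (0 : ℝ) = ⋃ m, Set.Ico (eventTime w m) (eventTime w (m + 1)) := by
  have h := iUnion_Ico_map_succ_eq_Ici (f := eventTime w) (fun m => eventTime_mono hw (Nat.zero_le m))
    (by
      rw [not_bddAbove_iff]
      intro x
      obtain ⟨m, hm⟩ := (hT.eventually_gt_atTop x).exists
      exact ⟨_, ⟨m, rfl⟩, hm⟩)
  have h0 : eventTime w ⊥ = 0 := by simp [eventTime]
  rw [h0] at h
  exact h.symm

theorem pathCost_eq_tsum (M : Params) (p : Policy) (s : State) {w : Sample}
    (hw : ∀ i, 0 ≤ (w i).1) (hT : Filter.Tendsto (eventTime w) Filter.atTop Filter.atTop) :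
    ∫⁻ t in Set.Ici (0 : ℝ),
      ENNReal.ofReal (Real.exp (-M.beta * t)) * ((stateAt p s w t).jobs : ℝ≥0∞)
    = ∑' m, ENNReal.ofReal (Real.exp (-M.beta * eventTime w m)) *
        ((stateAfter p s w m).jobs : ℝ≥0∞) *
        ENNReal.ofReal ((1 - Real.exp (-M.beta * (w m).1)) / M.beta) := by
  rw [iUnion_Ico_eventTime hw hT, lintegral_iUnion (fun _ => measurableSet_Ico)
    (by simpa using (eventTime_mono hw).pairwise_disjoint_on_Ico_succ)]
  refine tsum_congr fun m => ?_
  rw [setLIntegral_congr_fun measurableSet_Ico (g := fun t =>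
    ENNReal.ofReal (Real.exp (-M.beta * t)) * ((stateAfter p s w m).jobs : ℝ≥0∞))
    (fun t ht => by simp only [stateAt, eventCount_eq hw ht]),
    lintegral_mul_const _ (by fun_prop),
    lintegral_exp_Ico M.beta_pos (eventTime_mono hw (Nat.le_succ m))]
  have : eventTime w (m + 1) - eventTime w m = (w m).1 := by
    simp [eventTime, Finset.sum_range_succ]
  rw [this]
  ring

/-! ### First-event equation and linear growth of the cost -/

/-- Expected discounted cost incurred between the `m`-th event and the next one. -/
noncomputable def stageCost (M : Params) (p : Policy) (m : ℕ) (s : State) : ℝ≥0∞ :=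
  discMoment M M.beta p (fun s => (s.jobs : ℝ≥0∞))
    (fun g => ENNReal.ofReal ((1 - Real.exp (-M.beta * g)) / M.beta)) m s

theorem measurable_gapCost (M : Params) :
    Measurable fun g : ℝ => ENNReal.ofReal ((1 - Real.exp (-M.beta * g)) / M.beta) := by
  fun_prop

theorem cost_eq_tsum (M : Params) (p : Policy) (s : State) :
    M.cost s p = ∑' m, stageCost M p m s := by
  unfold Params.cost stageCost discMoment
  rw [← lintegral_tsum fun m => (measurable_discMoment_integrand M.beta p
    (fun s => (s.jobs : ℝ≥0∞)) (measurable_gapCost M) m s).aemeasurable]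
  refine lintegral_congr_ae ?_
  filter_upwards [ae_gap_nonneg M, ae_tendsto_eventTime M] with w hw hT
  exact pathCost_eq_tsum M p s hw hT

theorem stageCost_zero (M : Params) (p : Policy) (s : State) :
    stageCost M p 0 s =
      ((settle p s).jobs : ℝ≥0∞) * ENNReal.ofReal (1 / (M.beta + M.totalRate)) := by
  unfold stageCost
  rw [discMoment_zero M _ p _ (measurable_gapCost M),
    lintegral_one_sub_exp_expMeasure M.totalRate_pos M.beta_pos]

theorem stageCost_succ (M : Params) (p : Policy) (m : ℕ) (s : State) :
    stageCost M p (m + 1) s = ∑ e, ENNReal.ofReal (M.rate e / (M.beta + M.totalRate)) *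
      stageCost M p m (react e (settle p s)) :=
  discMoment_succ M M.beta_pos p _ (measurable_gapCost M) m s

theorem cost_eq (M : Params) (p : Policy) (s : State) :
    M.cost s p = ((settle p s).jobs : ℝ≥0∞) * ENNReal.ofReal (1 / (M.beta + M.totalRate)) +
      ∑ e, ENNReal.ofReal (M.rate e / (M.beta + M.totalRate)) *
        M.cost (react e (settle p s)) p := by
  rw [cost_eq_tsum, tsum_eq_zero_add' ENNReal.summable, stageCost_zero]
  congr 1
  simp_rw [stageCost_succ, cost_eq_tsum]
  rw [Summable.tsum_finsetSum fun _ _ => ENNReal.summable]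
  simp_rw [ENNReal.tsum_mul_left]

theorem jobs_assign {s : State} {a : Action} (ha : a ∈ admissible s) :
    (assign a s).jobs = s.jobs := by
  cases a
  · rfl
  · obtain ⟨h1, h2⟩ := ha
    simp only [assign, State.jobs, h2]
    simp; omega
  · obtain ⟨h1, h2⟩ := ha
    simp only [assign, State.jobs, h2]
    simp; omega

theorem jobs_settle (p : Policy) (s : State) : (settle p s).jobs = s.jobs := by
  unfold settle
  simp only
  rw [jobs_assign (p.act_mem _), jobs_assign (p.act_mem _)]

theorem jobs_react_le (e : Event) (s : State) : (react e s).jobs ≤ s.jobs + 1 := by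
  cases e
  · simp only [react, arrive, State.jobs]; omega
  all_goals
    simp only [react]
    split_ifs with h
    · simp only [State.jobs, h]
      try simp
      try omega
    · omega

theorem Params.beta_add_totalRate_pos (M : Params) : 0 < M.beta + M.totalRate := by
  have := M.beta_pos
  have := M.totalRate_pos
  positivity

/-- Each event adds at most one job and costs a discount `R / (β + R)`. With the weight `n + L`, `L
= 2 R / β`, one has `R (n + 1 + L) ≤ (R + β / 2) (n + L)`, hence geometric decay with a ratio below
1. -/
theorem stageCost_le (M : Params) (p : Policy) (m : ℕ) (s : State) :
    stageCost M p m s ≤ ENNReal.ofReal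
      ((((M.totalRate + M.beta / 2) / (M.beta + M.totalRate)) ^ m / (M.beta + M.totalRate)) *
        (s.jobs + 2 * M.totalRate / M.beta)) := by
  have hb := M.beta_pos
  have hR := M.totalRate_pos
  have hS := M.beta_add_totalRate_pos
  induction m generalizing s with
  | zero =>
    rw [stageCost_zero, jobs_settle, ← ENNReal.ofReal_natCast, ← ENNReal.ofReal_mul (by positivity)]
    refine ENNReal.ofReal_le_ofReal ?_
    rw [pow_zero, mul_comm]
    gcongr
    have : 0 ≤ 2 * M.totalRate / M.beta := by positivity
    linarith
  | succ m ih =>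
    rw [stageCost_succ]
    set ρ := (M.totalRate + M.beta / 2) / (M.beta + M.totalRate) with hρ
    have hρ0 : 0 ≤ ρ := by positivity
    calc _ ≤ ∑ e, ENNReal.ofReal (M.rate e / (M.beta + M.totalRate)) *
          ENNReal.ofReal ((ρ ^ m / (M.beta + M.totalRate)) *
            (s.jobs + 1 + 2 * M.totalRate / M.beta)) := by
          gcongr with e
          refine (ih _).trans (ENNReal.ofReal_le_ofReal ?_)
          gcongr
          have := jobs_react_le e (settle p s)
          rw [jobs_settle] at this
          exact_mod_cast this
      _ = ENNReal.ofReal (M.totalRate / (M.beta + M.totalRate) *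
          ((ρ ^ m / (M.beta + M.totalRate)) * (s.jobs + 1 + 2 * M.totalRate / M.beta))) := by
          rw [← Finset.sum_mul, ← ENNReal.ofReal_sum_of_nonneg
            (fun e _ => div_nonneg (M.rate_pos e).le hS.le), ← Finset.sum_div,
            ← ENNReal.ofReal_mul (div_nonneg (Finset.sum_nonneg fun e _ => (M.rate_pos e).le) hS.le)]
          rfl
      _ ≤ _ := by
          refine ENNReal.ofReal_le_ofReal ?_
          have h1 : M.totalRate / (M.beta + M.totalRate) * (s.jobs + 1 + 2 * M.totalRate / M.beta)
              ≤ ρ * (s.jobs + 2 * M.totalRate / M.beta) := by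
            rw [hρ, div_mul_eq_mul_div, div_mul_eq_mul_div]
            gcongr ?_ / _
            have : M.beta / 2 * (2 * M.totalRate / M.beta) = M.totalRate := by field_simp
            have h3 : 0 ≤ M.beta / 2 * s.jobs := by positivity
            nlinarith
          have h2 : 0 ≤ ρ ^ m / (M.beta + M.totalRate) := by positivity
          calc _ = (ρ ^ m / (M.beta + M.totalRate)) * (M.totalRate / (M.beta + M.totalRate) *
                (s.jobs + 1 + 2 * M.totalRate / M.beta)) := by ring
            _ ≤ (ρ ^ m / (M.beta + M.totalRate)) * (ρ * (s.jobs + 2 * M.totalRate / M.beta)) := by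
                gcongr
            _ = _ := by rw [pow_succ]; ring

theorem exists_cost_le (M : Params) (p : Policy) :
    ∃ C : ℝ, 0 ≤ C ∧ ∀ s, M.cost s p ≤ ENNReal.ofReal (C * (s.jobs + 1)) := by
  have hb := M.beta_pos
  have hR := M.totalRate_pos
  have hS := M.beta_add_totalRate_pos
  set ρ := (M.totalRate + M.beta / 2) / (M.beta + M.totalRate) with hρ
  have hρ0 : 0 ≤ ρ := by positivity
  have hρ1 : ρ < 1 := by rw [hρ, div_lt_one hS]; linarith
  set L := 2 * M.totalRate / M.beta
  have hL : 0 ≤ L := by positivity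
  have hgeom := hasSum_geometric_of_lt_one hρ0 hρ1
  have h1ρ : 0 < 1 - ρ := by linarith
  refine ⟨(1 - ρ)⁻¹ / (M.beta + M.totalRate) * (1 + L), by positivity, fun s => ?_⟩
  rw [cost_eq_tsum]
  have hs := ((hgeom.div_const (M.beta + M.totalRate)).mul_right ((s.jobs : ℝ) + L))
  calc _ ≤ ∑' m, ENNReal.ofReal ((ρ ^ m / (M.beta + M.totalRate)) * (s.jobs + L)) :=
        ENNReal.tsum_le_tsum fun m => stageCost_le M p m s
    _ = ENNReal.ofReal ((1 - ρ)⁻¹ / (M.beta + M.totalRate) * (s.jobs + L)) := by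
        rw [← hs.tsum_eq, ENNReal.ofReal_tsum_of_nonneg (fun m => by positivity) hs.summable]
    _ ≤ _ := by
        refine ENNReal.ofReal_le_ofReal ?_
        rw [mul_assoc _ (1 + L)]
        gcongr
        have : (0 : ℝ) ≤ s.jobs := by positivity
        nlinarith

/-- The discounted cost-to-go as a real number. -/
noncomputable def rcost (M : Params) (p : Policy) (s : State) : ℝ := (M.cost s p).toReal

theorem cost_ne_top (M : Params) (p : Policy) (s : State) : M.cost s p ≠ ∞ := by
  obtain ⟨C, _, hC⟩ := exists_cost_le M p
  exact ne_top_of_le_ne_top ENNReal.ofReal_ne_top (hC s)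

theorem rcost_nonneg (M : Params) (p : Policy) (s : State) : 0 ≤ rcost M p s :=
  ENNReal.toReal_nonneg

theorem exists_rcost_le (M : Params) (p : Policy) :
    ∃ C : ℝ, 0 ≤ C ∧ ∀ s, rcost M p s ≤ C * (s.jobs + 1) := by
  obtain ⟨C, h0, hC⟩ := exists_cost_le M p
  exact ⟨C, h0, fun s => ENNReal.toReal_le_of_le_ofReal (by positivity) (hC s)⟩

theorem rcost_eq (M : Params) (p : Policy) (s : State) :
    (M.beta + M.totalRate) * rcost M p s = s.jobs +
      ∑ e, M.rate e * rcost M p (react e (settle p s)) := by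
  have hS := M.beta_add_totalRate_pos
  have h := congrArg ENNReal.toReal (cost_eq M p s)
  rw [ENNReal.toReal_add (ENNReal.mul_ne_top (ENNReal.natCast_ne_top _) ENNReal.ofReal_ne_top)
    (ENNReal.sum_ne_top.mpr fun e _ => ENNReal.mul_ne_top ENNReal.ofReal_ne_top
      (cost_ne_top M p _)), ENNReal.toReal_sum
    (fun e _ => ENNReal.mul_ne_top ENNReal.ofReal_ne_top (cost_ne_top M p _))] at h
  simp only [ENNReal.toReal_mul, ENNReal.toReal_natCast,
    ENNReal.toReal_ofReal (show 0 ≤ 1 / (M.beta + M.totalRate) by positivity), jobs_settle,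
    fun e => ENNReal.toReal_ofReal (div_nonneg (M.rate_pos e).le hS.le)] at h
  change rcost M p s = _ + ∑ e, M.rate e / (M.beta + M.totalRate) * rcost M p _ at h
  rw [h, mul_add, Finset.mul_sum]
  congr 1
  · field_simp
  · refine Finset.sum_congr rfl fun e _ => ?_
    field_simp

/-! ### Maximum principle -/

/-- Maximum principle for functions of linear growth along a discounted chain whose size grows by
at most one per step. -/
theorem nonpos_of_discounted_step {X : Type*} {R b : ℝ} (hR : 0 ≤ R) (hb : 0 < b) (d : X → ℝ)
    (n : X → ℕ) (hbd : ∃ C : ℝ, ∀ x, d x ≤ C * (n x + 1))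
    (step : ∀ C L : ℝ, 0 ≤ C → 1 ≤ L → (∀ x, d x ≤ C * (n x + L)) →
      ∀ x, (b + R) * d x ≤ R * (C * (n x + 1 + L))) (x : X) : d x ≤ 0 := by
  obtain ⟨C, hC⟩ := hbd
  -- The summand `2 * R / b` absorbs the growth by one: each use of `step` then shrinks the bound by
  -- the factor `ρ < 1`.
  set L : ℝ := 1 + 2 * R / b with hLdef
  have hRb : 0 ≤ 2 * R / b := by positivity
  have hL : 1 ≤ L := by linarith
  set ρ : ℝ := (R + b / 2) / (b + R) with hρ
  have hρ0 : 0 ≤ ρ := by positivity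
  have hρ1 : ρ < 1 := by rw [hρ, div_lt_one (by positivity)]; linarith
  have key : ∀ j : ℕ, ∀ x, d x ≤ (max C 0 * ρ ^ j) * (n x + L) := by
    intro j
    induction j with
    | zero =>
      intro x
      calc d x ≤ C * (n x + 1) := hC x
        _ ≤ max C 0 * (n x + 1) := by gcongr; exact le_max_left _ _
        _ ≤ max C 0 * ρ ^ 0 * (n x + L) := by
          rw [pow_zero, mul_one]
          gcongr
    | succ j ih =>
      intro x
      have hC0 : 0 ≤ max C 0 * ρ ^ j := mul_nonneg (le_max_right _ _) (pow_nonneg hρ0 j)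
      have h := step _ L hC0 hL ih x
      have h2 : R * (n x + 1 + L) ≤ (R + b / 2) * (n x + L) := by
        have h3 : b / 2 * (2 * R / b) = R := by field_simp
        have h4 : 0 ≤ b / 2 * n x := by positivity
        have h5 : b / 2 * L = b / 2 + R := by rw [hLdef, mul_add, h3, mul_one]
        nlinarith
      have h3 : (b + R) * d x ≤ (max C 0 * ρ ^ j) * ((R + b / 2) * (n x + L)) := by
        calc _ ≤ _ := h
          _ = (max C 0 * ρ ^ j) * (R * (n x + 1 + L)) := by ring
          _ ≤ _ := by gcongr
      rw [← le_div_iff₀' (by positivity)] at h3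
      calc d x ≤ _ := h3
        _ = _ := by rw [pow_succ, hρ]; ring
  have hlim : Filter.Tendsto (fun j => (max C 0 * ρ ^ j) * (n x + L)) Filter.atTop
      (nhds ((max C 0 * 0) * (n x + L))) :=
    ((tendsto_pow_atTop_nhds_zero_of_lt_one hρ0 hρ1).const_mul _).mul_const _
  rw [mul_zero, zero_mul] at hlim
  exact ge_of_tendsto' hlim fun j => key j x

/-! ### One-state deviations from an optimal policy -/

theorem settle_eq_self {p : Policy} {s : State} (h : p s = Action.idle) : settle p s = s := by
  simp [settle, h, assign]

theorem settle_assign (p : Policy) (s : State) : settle p (assign (p s) s) = settle p s := by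
  have h := settle_idle p s
  have : settle p (assign (p s) s) = assign (p (settle p s)) (settle p s) := rfl
  rw [this, h]
  rfl

theorem idle_mem_admissible (s : State) : Action.idle ∈ admissible s := trivial

theorem assign_ne {a : Action} {s : State} (ha : a ∈ admissible s) (h : a ≠ Action.idle) :
    (assign a s).n0 < s.n0 := by
  cases a
  · exact absurd rfl h
  all_goals
    obtain ⟨h1, _⟩ := ha
    simp only [assign]
    omega

theorem rcost_congr (M : Params) (p : Policy) {s t : State} (h : settle p s = settle p t) :
    rcost M p s = rcost M p t := by
  have hS := M.beta_add_totalRate_pos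
  have hj : s.jobs = t.jobs := by rw [← jobs_settle p s, h, jobs_settle]
  have h1 := rcost_eq M p s
  rw [h, hj, ← rcost_eq M p t] at h1
  exact mul_left_cancel₀ hS.ne' h1

open Classical in
/-- The policy that agrees with `p` except that it takes action `a` in state `s0`. -/
noncomputable def Policy.replace (p : Policy) (s0 : State) (a : Action) (ha : a ∈ admissible s0) :
    Policy where
  act s := if s = s0 then a else p s
  act_mem s := by
    split_ifs with h
    · rwa [h]
    · exact p.act_mem s

section Replace

variable (p : Policy) (s0 : State) (a : Action) (ha : a ∈ admissible s0)

theorem replace_self : p.replace s0 a ha s0 = a := if_pos rfl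

theorem replace_of_ne {s : State} (h : s ≠ s0) : p.replace s0 a ha s = p s := if_neg h

/-- If `p` leads from `s` into `s0`, one of the two assignments allowed by `settle` is spent, so the
modified policy stops right after applying `a` at `s0`. -/
theorem settle_replace_of_ne {s : State} (h : s ≠ s0) :
    settle (p.replace s0 a ha) s = settle p s ∨
      (settle p s = settle p s0 ∧ settle (p.replace s0 a ha) s = assign a s0) := by
  have h1 : p.replace s0 a ha s = p s := replace_of_ne p s0 a ha h
  by_cases h2 : assign (p s) s = s0
  · right
    constructor
    · rw [← settle_assign p s, h2]
    · simp only [settle, h1, h2, replace_self]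
  · left
    simp only [settle, h1, replace_of_ne p s0 a ha h2]

theorem settle_replace_idle (h : a = Action.idle) : settle (p.replace s0 a ha) s0 = s0 :=
  settle_eq_self (by rw [replace_self, h])

theorem settle_replace_self (h : a ≠ Action.idle) :
    settle (p.replace s0 a ha) s0 = settle p (assign a s0) := by
  have h1 := assign_ne ha h
  have hne : assign a s0 ≠ s0 := fun h2 => by rw [h2] at h1; exact lt_irrefl _ h1
  have hs : settle (p.replace s0 a ha) s0 = assign (p (assign a s0)) (assign a s0) := by
    simp only [settle, replace_self, replace_of_ne p s0 a ha hne]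
  have hi := settle_idle (p.replace s0 a ha) s0
  rw [hs] at hi ⊢
  have hne2 : assign (p (assign a s0)) (assign a s0) ≠ s0 := by
    intro h2
    by_cases h3 : p (assign a s0) = Action.idle
    · rw [h3] at h2; exact hne h2
    · have h4 := assign_ne (p.act_mem (assign a s0)) h3
      have h5 := congrArg State.n0 h2
      change (assign (p.act (assign a s0)) (assign a s0)).n0 = s0.n0 at h5
      omega
  rw [replace_of_ne p s0 a ha hne2] at hi
  rw [← settle_assign, settle_eq_self hi]

theorem settle_assign_of_replace (h : a ≠ Action.idle) {s : State}
    (hs : settle (p.replace s0 a ha) s = assign a s0) : settle p (assign a s0) = assign a s0 := by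
  have h1 := assign_ne ha h
  have hne : assign a s0 ≠ s0 := fun h2 => by rw [h2] at h1; exact lt_irrefl _ h1
  have hi := settle_idle (p.replace s0 a ha) s
  rw [hs, replace_of_ne p s0 a ha hne] at hi
  exact settle_eq_self hi

end Replace

/-- The maximum principle applied to `rcost M q - f`. It needs growth bounds from above only, so
nonnegativity of `f` suffices. -/
theorem rcost_le_of_superharmonic (M : Params) (q : Policy) {f : State → ℝ} (hf0 : ∀ s, 0 ≤ f s)
    (hf : ∀ s, s.jobs + ∑ e, M.rate e * f (react e (settle q s))
      ≤ (M.beta + M.totalRate) * f s) (s : State) : rcost M q s ≤ f s := by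
  have hR := M.totalRate_pos
  obtain ⟨C, hC0, hC⟩ := exists_rcost_le M q
  refine sub_nonpos.mp (nonpos_of_discounted_step hR.le M.beta_pos (fun s => rcost M q s - f s)
    State.jobs ⟨C, fun s => by linarith [hC s, hf0 s]⟩ ?_ s)
  intro C L hC hL hd s
  rw [mul_sub, rcost_eq]
  have h1 : ∑ e, M.rate e * rcost M q (react e (settle q s))
      - ∑ e, M.rate e * f (react e (settle q s)) ≤ M.totalRate * (C * (s.jobs + 1 + L)) := by
    unfold Params.totalRate
    rw [← Finset.sum_sub_distrib, Finset.sum_mul]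
    refine Finset.sum_le_sum fun e _ => ?_
    rw [← mul_sub]
    refine mul_le_mul_of_nonneg_left ((hd _).trans ?_) (M.rate_pos e).le
    gcongr
    have := jobs_react_le e (settle q s)
    rw [jobs_settle] at this
    exact_mod_cast this
  linarith [hf s]

theorem rcost_le_of_delayOptimal {M : Params} {p : Policy} (hopt : M.DelayOptimal p) (q : Policy)
    (s : State) : rcost M p s ≤ rcost M q s := by
  refine ENNReal.toReal_mono (cost_ne_top M q s) ?_
  rw [hopt s]
  exact iInf_le _ q

/-- A one-state deviation of an optimal policy does not improve it. -/
theorem rcost_mul_le_of_replace {M : Params} {p : Policy} (hopt : M.DelayOptimal p) {s0 : State}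
    {a : Action} (ha : a ∈ admissible s0) {U : ℝ}
    (hself : s0.jobs + ∑ e, M.rate e * rcost M p (react e (settle (p.replace s0 a ha) s0)) = U)
    (hne : ∀ s, s ≠ s0 → settle (p.replace s0 a ha) s = assign a s0 →
      s0.jobs + ∑ e, M.rate e * rcost M p (react e (assign a s0)) = U) :
    (M.beta + M.totalRate) * rcost M p s0 ≤ U := by
  -- If the deviation were strictly better at `s0`, the cost of `p` would be superharmonic for the
  -- modified policy. That policy would then cost at most as much everywhere and strictly less at
  -- `s0`, against optimality.
  by_contra hlt
  rw [not_le] at hlt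
  have hS := M.beta_add_totalRate_pos
  set q := p.replace s0 a ha
  have hsup : ∀ s, s.jobs + ∑ e, M.rate e * rcost M p (react e (settle q s))
      ≤ (M.beta + M.totalRate) * rcost M p s := by
    intro s
    by_cases hs : s = s0
    · rw [hs, hself]; exact hlt.le
    · rcases settle_replace_of_ne p s0 a ha hs with h | ⟨h1, h2⟩
      · rw [rcost_eq M p s]
        exact le_of_eq (by rw [h])
      · have hj : s.jobs = s0.jobs := by rw [← jobs_settle p s, h1, jobs_settle]
        rw [h2, hj, hne s hs h2, rcost_congr M p h1]
        exact hlt.le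
  have hle := rcost_le_of_superharmonic M q (rcost_nonneg M p) hsup
  have h1 := rcost_eq M q s0
  have h2 : ∑ e, M.rate e * rcost M q (react e (settle q s0)) ≤
      ∑ e, M.rate e * rcost M p (react e (settle q s0)) :=
    Finset.sum_le_sum fun e _ => mul_le_mul_of_nonneg_left (hle _) (M.rate_pos e).le
  have h3 := mul_le_mul_of_nonneg_left (rcost_le_of_delayOptimal hopt q s0) hS.le
  linarith

theorem rcost_le_wait {M : Params} {p : Policy} (hopt : M.DelayOptimal p) (s : State) :
    (M.beta + M.totalRate) * rcost M p s ≤ s.jobs + ∑ e, M.rate e * rcost M p (react e s) :=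
  rcost_mul_le_of_replace hopt (idle_mem_admissible s)
    (by rw [settle_replace_idle _ _ _ _ rfl]) (fun _ _ _ => rfl)

theorem rcost_le_assign {M : Params} {p : Policy} (hopt : M.DelayOptimal p) {s : State}
    {a : Action} (ha : a ∈ admissible s) : rcost M p s ≤ rcost M p (assign a s) := by
  by_cases h : a = Action.idle
  · rw [h]; rfl
  refine le_of_mul_le_mul_left ?_ M.beta_add_totalRate_pos
  have hj := jobs_assign ha
  refine rcost_mul_le_of_replace hopt ha ?_ ?_
  · rw [settle_replace_self p s a ha h, rcost_eq M p (assign a s), hj]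
  · intro t _ ht
    rw [rcost_eq M p (assign a s), hj, settle_assign_of_replace p s a ha h ht]

theorem rcost_assign_act (M : Params) (p : Policy) (s : State) :
    rcost M p (assign (p s) s) = rcost M p s :=
  rcost_congr M p (settle_assign p s)

/-! ### Optimality equations -/

/-- The optimality equations of the offloading system with event rates `a`, `l`, `c1`, `c2` and
discount rate `b`, for a policy `p` with cost-to-go `V`. -/
structure OptimalityEq (a l c1 c2 b : ℝ) (p : Policy) (V : State → ℝ) : Prop where
  a_pos : 0 < a
  l_pos : 0 < l
  l_lt : l < c1
  c1_lt : c1 < c2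
  b_pos : 0 < b
  nonneg : ∀ s, 0 ≤ V s
  growth : ∃ C : ℝ, 0 ≤ C ∧ ∀ s, V s ≤ C * (s.jobs + 1)
  act_eq : ∀ s, V (assign (p s) s) = V s
  le_assign : ∀ s, ∀ x ∈ admissible s, V s ≤ V (assign x s)
  le_wait : ∀ s, (b + (a + l + c1 + c2)) * V s ≤ s.jobs + (a * V (react Event.arrival s) +
    l * V (react Event.tickL2 s) + c1 * V (react Event.tickC1 s) + c2 * V (react Event.tickC2 s))
  idle_eq : ∀ s, p s = Action.idle → (b + (a + l + c1 + c2)) * V s = s.jobs +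
    (a * V (react Event.arrival s) + l * V (react Event.tickL2 s) +
      c1 * V (react Event.tickC1 s) + c2 * V (react Event.tickC2 s))

theorem sum_event (f : Event → ℝ) :
    ∑ e, f e = f Event.arrival + f Event.tickL2 + f Event.tickC1 + f Event.tickC2 := by
  have : (Finset.univ : Finset Event) =
      {Event.arrival, Event.tickL2, Event.tickC1, Event.tickC2} := rfl
  rw [this]
  simp [add_assoc]

theorem optimalityEq_rcost {M : Params} {p : Policy} (hopt : M.DelayOptimal p) :
    OptimalityEq M.lam M.muL2 M.muC1 M.muC2 M.beta p (rcost M p) := by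
  have hm := M.mu0_pos
  have hK : 0 < M.K := by linarith [M.one_lt_K]
  have hf : 0 < M.f := lt_trans (by positivity) M.inv_K_lt_f
  have hf' : 0 < 1 - M.f := by linarith [M.f_lt_one]
  have hR : M.totalRate = M.lam + M.muL2 + M.muC1 + M.muC2 := sum_event M.rate
  refine ⟨M.lam_pos, M.rate_pos Event.tickL2, ?_, ?_, M.beta_pos, rcost_nonneg M p,
    exists_rcost_le M p, rcost_assign_act M p, fun s x hx => rcost_le_assign hopt hx, ?_, ?_⟩
  · have h := M.inv_K_lt_f
    rw [div_lt_iff₀ hK] at h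
    rw [Params.muL2, Params.muC1, div_lt_iff₀ hf]
    nlinarith
  · rw [Params.muC1, Params.muC2, lt_div_iff₀ hf']
    have : 0 < M.K * M.mu0 * M.f := by positivity
    linarith
  · intro s
    have h := rcost_le_wait hopt s
    rw [hR, sum_event] at h
    exact h
  · intro s hs
    have h := rcost_eq M p s
    rw [hR, sum_event, settle_eq_self hs] at h
    exact h

theorem fin_two_eq (i : Fin 2) : i = 0 ∨ i = 1 := by omega

theorem act_full (p : Policy) (m k : ℕ) : p ⟨m, 1, 1, k⟩ = Action.idle := by
  have h := p.act_mem ⟨m, 1, 1, k⟩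
  cases hx : p.act ⟨m, 1, 1, k⟩
  · rfl
  all_goals
    rw [hx] at h
    exact absurd h.2 (by simp)

theorem act_empty (p : Policy) (i2 i1 : Fin 2) (k : ℕ) : p ⟨0, i2, i1, k⟩ = Action.idle := by
  have h := p.act_mem ⟨0, i2, i1, k⟩
  cases hx : p.act ⟨0, i2, i1, k⟩
  · rfl
  all_goals
    rw [hx] at h
    exact absurd h.1 (by simp)

theorem act_ne_SM1 (p : Policy) (m : ℕ) (i2 : Fin 2) (k : ℕ) :
    p ⟨m, i2, 1, k⟩ ≠ Action.SM1 := by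
  intro hx
  have h := p.act_mem ⟨m, i2, 1, k⟩
  rw [hx] at h
  exact absurd h.2 (by simp)

theorem act_ne_SM2 (p : Policy) (m : ℕ) (i1 : Fin 2) (k : ℕ) :
    p ⟨m, 1, i1, k⟩ ≠ Action.SM2 := by
  intro hx
  have h := p.act_mem ⟨m, 1, i1, k⟩
  rw [hx] at h
  exact absurd h.2 (by simp)

/-! ### Monotonicity of the cost-to-go -/

/-- Componentwise order on states. -/
def Dominated (s t : State) : Prop := s.n0 ≤ t.n0 ∧ s.i2 ≤ t.i2 ∧ s.i1 ≤ t.i1 ∧ s.n2 ≤ t.n2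

theorem Dominated.jobs_le {s t : State} (h : Dominated s t) : s.jobs ≤ t.jobs := by
  obtain ⟨h0, h2, h1, h3⟩ := h
  have h2' : (s.i2 : ℕ) ≤ t.i2 := h2
  have h1' : (s.i1 : ℕ) ≤ t.i1 := h1
  unfold State.jobs
  omega

theorem Dominated.react {s t : State} (h : Dominated s t) (e : Event) :
    Dominated (react e s) (react e t) := by
  obtain ⟨m, i2, i1, k⟩ := s
  obtain ⟨m', i2', i1', k'⟩ := t
  obtain ⟨h0, h2, h1, h3⟩ := h
  simp only at h0 h2 h1 h3
  cases e
  · exact ⟨by simp [Offloading.react, arrive, h0], h2, h1, h3⟩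
  all_goals
    simp only [Offloading.react, Dominated]
    split_ifs <;> simp_all <;> omega

namespace OptimalityEq

variable {a l c1 c2 b : ℝ} {p : Policy} {V : State → ℝ}

/-- Coupling principle. One number `B` can bound all pairs reached by the next event, because the
bound in the maximum principle depends only on the number of jobs. -/
theorem compare (h : OptimalityEq a l c1 c2 b p V) {X : Type*} (f g : X → State)
    (step : ∀ B : ℝ, 0 ≤ B → ∀ x,
      (∀ y, (f y).jobs ≤ (f x).jobs + 1 → V (f y) - V (g y) ≤ B) →
      (b + (a + l + c1 + c2)) * (V (f x) - V (g x)) ≤ (a + l + c1 + c2) * B) (x : X) :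
    V (f x) ≤ V (g x) := by
  obtain ⟨C, hC0, hC⟩ := h.growth
  have hR : 0 ≤ a + l + c1 + c2 := by linarith [h.a_pos, h.l_pos, h.l_lt, h.c1_lt]
  refine sub_nonpos.mp (nonpos_of_discounted_step hR h.b_pos (fun x => V (f x) - V (g x))
    (fun x => (f x).jobs) ⟨C, fun x => by linarith [hC (f x), h.nonneg (g x)]⟩ ?_ x)
  intro C L hC hL hd x
  refine step _ (by positivity) x fun y hy => (hd y).trans ?_
  gcongr
  exact_mod_cast hy

theorem sm1_le (h : OptimalityEq a l c1 c2 b p V) (m : ℕ) (i2 : Fin 2) (k : ℕ) :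
    V ⟨m + 1, i2, 0, k⟩ ≤ V ⟨m, i2, 1, k⟩ :=
  h.le_assign ⟨m + 1, i2, 0, k⟩ Action.SM1 ⟨Nat.le_add_left 1 m, rfl⟩

theorem sm2_le (h : OptimalityEq a l c1 c2 b p V) (m : ℕ) (i1 : Fin 2) (k : ℕ) :
    V ⟨m + 1, 0, i1, k⟩ ≤ V ⟨m, 1, i1, k⟩ :=
  h.le_assign ⟨m + 1, 0, i1, k⟩ Action.SM2 ⟨Nat.le_add_left 1 m, rfl⟩

theorem sm1_eq (h : OptimalityEq a l c1 c2 b p V) {m : ℕ} {i2 i1 : Fin 2} {k : ℕ}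
    (hp : p ⟨m + 1, i2, i1, k⟩ = Action.SM1) : V ⟨m + 1, i2, i1, k⟩ = V ⟨m, i2, 1, k⟩ := by
  have := h.act_eq ⟨m + 1, i2, i1, k⟩
  rw [hp] at this
  exact this.symm

theorem sm2_eq (h : OptimalityEq a l c1 c2 b p V) {m : ℕ} {i2 i1 : Fin 2} {k : ℕ}
    (hp : p ⟨m + 1, i2, i1, k⟩ = Action.SM2) : V ⟨m + 1, i2, i1, k⟩ = V ⟨m, 1, i1, k⟩ := by
  have := h.act_eq ⟨m + 1, i2, i1, k⟩
  rw [hp] at this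
  exact this.symm

/-- The smaller state imitates the larger one. If it cannot, the mode is free in both, so its base
queue is empty and skipping the action preserves the order. -/
theorem exists_dominated_assign (h : OptimalityEq a l c1 c2 b p V) {s t : State}
    (hst : Dominated s t) {x : Action} (hx : x ∈ admissible t) :
    ∃ s', V s ≤ V s' ∧ s'.jobs = s.jobs ∧ Dominated s' (assign x t) := by
  by_cases hs : x ∈ admissible s
  · refine ⟨assign x s, h.le_assign s x hs, jobs_assign hs, ?_⟩
    obtain ⟨h0, h2, h1, h3⟩ := hst
    cases x
    · exact ⟨h0, h2, h1, h3⟩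
    · exact ⟨Nat.sub_le_sub_right h0 1, h2, le_rfl, h3⟩
    · exact ⟨Nat.sub_le_sub_right h0 1, le_rfl, h1, h3⟩
  · refine ⟨s, le_rfl, rfl, ?_⟩
    obtain ⟨h0, h2, h1, h3⟩ := hst
    cases x
    · exact absurd trivial hs
    · have hx1 : 1 ≤ t.n0 := hx.1
      have hx2 : t.i1 = 0 := hx.2
      have hs1 : s.i1 = 0 := by rw [hx2] at h1; exact le_antisymm h1 (Fin.zero_le _)
      have hs0 : s.n0 = 0 := by
        by_contra hne
        exact hs ⟨Nat.one_le_iff_ne_zero.mpr hne, hs1⟩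
      exact ⟨by simp [assign, hs0], h2, by simp [assign, hs1], h3⟩
    · have hx1 : 1 ≤ t.n0 := hx.1
      have hx2 : t.i2 = 0 := hx.2
      have hs1 : s.i2 = 0 := by rw [hx2] at h2; exact le_antisymm h2 (Fin.zero_le _)
      have hs0 : s.n0 = 0 := by
        by_contra hne
        exact hs ⟨Nat.one_le_iff_ne_zero.mpr hne, hs1⟩
      exact ⟨by simp [assign, hs0], by simp [assign, hs1], h1, h3⟩

theorem exists_dominated_settle (h : OptimalityEq a l c1 c2 b p V) {s t : State}
    (hst : Dominated s t) :
    ∃ s', V s ≤ V s' ∧ s'.jobs = s.jobs ∧ Dominated s' (settle p t) ∧ V (settle p t) = V t := by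
  obtain ⟨s1, h1, hj1, hd1⟩ := h.exists_dominated_assign hst (p.act_mem t)
  obtain ⟨s2, h2, hj2, hd2⟩ := h.exists_dominated_assign hd1 (p.act_mem _)
  refine ⟨s2, h1.trans h2, hj2.trans hj1, hd2, ?_⟩
  unfold settle
  simp only
  rw [h.act_eq, h.act_eq]

/-- The cost-to-go is monotone in the state. -/
theorem mono (h : OptimalityEq a l c1 c2 b p V) {s t : State} (hst : Dominated s t) :
    V s ≤ V t := by
  have ha := h.a_pos
  have hl := h.l_pos
  have hc1 : 0 < c1 := hl.trans h.l_lt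
  have hc2 : 0 < c2 := hc1.trans h.c1_lt
  have hb := h.b_pos
  refine h.compare (X := {x : State × State // Dominated x.1 x.2}) (fun x => x.1.1)
    (fun x => x.1.2) ?_ ⟨(s, t), hst⟩
  rintro B hB ⟨⟨s, t⟩, hst⟩ hy
  simp only at hy ⊢
  obtain ⟨s', h1, hj, hd, h2⟩ := h.exists_dominated_settle hst
  have hs := h.le_wait s'
  have ht := h.idle_eq _ (settle_idle p t)
  rw [h2] at ht
  have hstep : ∀ e, V (react e s') - V (react e (settle p t)) ≤ B := fun e =>
    hy ⟨(react e s', react e (settle p t)), hd.react e⟩ (by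
      have := jobs_react_le e s'
      rwa [hj] at this)
  have hjobs : (s'.jobs : ℝ) ≤ (settle p t).jobs := by exact_mod_cast hd.jobs_le
  have hV := mul_le_mul_of_nonneg_left h1 (show 0 ≤ b + (a + l + c1 + c2) by positivity)
  have e1 := mul_le_mul_of_nonneg_left (hstep Event.arrival) ha.le
  have e2 := mul_le_mul_of_nonneg_left (hstep Event.tickL2) hl.le
  have e3 := mul_le_mul_of_nonneg_left (hstep Event.tickC1) hc1.le
  have e4 := mul_le_mul_of_nonneg_left (hstep Event.tickC2) hc2.le
  linarith

/-- Having strictly fewer jobs than a dominating state is worth at least one unit of cost until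
the next event. -/
theorem one_le_of_jobs_lt (h : OptimalityEq a l c1 c2 b p V) {s t : State} (hst : Dominated s t)
    (hlt : s.jobs < t.jobs) : 1 ≤ (b + (a + l + c1 + c2)) * (V t - V s) := by
  have ha := h.a_pos
  have hl := h.l_pos
  have hc1 : 0 < c1 := hl.trans h.l_lt
  have hc2 : 0 < c2 := hc1.trans h.c1_lt
  have hb := h.b_pos
  obtain ⟨s', h1, hj, hd, h2⟩ := h.exists_dominated_settle hst
  have hs := h.le_wait s'
  have ht := h.idle_eq _ (settle_idle p t)
  rw [h2] at ht
  have hV := mul_le_mul_of_nonneg_left h1 (show 0 ≤ b + (a + l + c1 + c2) by positivity)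
  have e1 := mul_le_mul_of_nonneg_left (h.mono (hd.react Event.arrival)) ha.le
  have e2 := mul_le_mul_of_nonneg_left (h.mono (hd.react Event.tickL2)) hl.le
  have e3 := mul_le_mul_of_nonneg_left (h.mono (hd.react Event.tickC1)) hc1.le
  have e4 := mul_le_mul_of_nonneg_left (h.mono (hd.react Event.tickC2)) hc2.le
  have hjobs : (s'.jobs : ℝ) + 1 ≤ (settle p t).jobs := by
    rw [jobs_settle, hj]
    exact_mod_cast hlt
  linarith

theorem lt_of_jobs_lt (h : OptimalityEq a l c1 c2 b p V) {s t : State} (hst : Dominated s t)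
    (hlt : s.jobs < t.jobs) : V s < V t := by
  have h1 := h.one_le_of_jobs_lt hst hlt
  have hR : 0 < b + (a + l + c1 + c2) := by
    linarith [h.a_pos, h.l_pos, h.l_lt, h.c1_lt, h.b_pos]
  by_contra hle
  nlinarith

/-! ### Comparing the possible positions of one job -/

/-- A lone job is better off in mode 1 than starting at the local server. -/
theorem sm1_le_sm2_of_single (h : OptimalityEq a l c1 c2 b p V) (hcf : CloudFirst p) :
    V ⟨0, 0, 1, 0⟩ ≤ V ⟨0, 1, 0, 0⟩ := by
  have ha := h.a_pos
  have hl := h.l_pos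
  have hlc := h.l_lt
  have hb := h.b_pos
  have hs := h.le_wait ⟨0, 0, 1, 0⟩
  have ht := h.idle_eq _ (act_empty p 1 0 0)
  simp [react, arrive, State.jobs] at hs ht
  have h1 := h.sm2_le 0 1 0
  have h2 : V ⟨1, 1, 0, 0⟩ = V ⟨0, 1, 1, 0⟩ := h.sm1_eq (hcf _ le_rfl rfl rfl)
  have h3 : V ⟨0, 0, 0, 0⟩ ≤ V ⟨0, 0, 0, 1⟩ := h.mono ⟨le_rfl, le_rfl, le_rfl, by simp⟩
  have h4 : V ⟨0, 0, 0, 0⟩ ≤ V ⟨0, 1, 0, 0⟩ := h.mono ⟨le_rfl, by simp, le_rfl, le_rfl⟩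
  rw [h2] at ht
  have e1 := mul_le_mul_of_nonneg_left h1 ha.le
  have e3 := mul_le_mul_of_nonneg_left h3 hl.le
  have e4 := mul_le_mul_of_nonneg_left h4 (sub_nonneg.mpr hlc.le)
  simp only [zero_add] at e1
  have key : 0 ≤ (b + a + c1) * (V ⟨0, 1, 0, 0⟩ - V ⟨0, 0, 1, 0⟩) := by linarith
  have := nonneg_of_mul_nonneg_right key (by linarith)
  linarith

/-- With a nonempty base queue, cloud-first fills the mode 1 slot on the right, and the resulting
state is one SM2 assignment away from the left one. -/
theorem sm1_le_sm2 (h : OptimalityEq a l c1 c2 b p V) (hcf : CloudFirst p) (m : ℕ) :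
    V ⟨m, 0, 1, 0⟩ ≤ V ⟨m, 1, 0, 0⟩ := by
  cases m with
  | zero => exact h.sm1_le_sm2_of_single hcf
  | succ m =>
    rw [h.sm1_eq (i2 := 1) (i1 := 0) (hcf _ (Nat.le_add_left 1 m) rfl rfl)]
    exact h.sm2_le m 1 0

/-- Completing the local service is beneficial. -/
theorem local_done_le (h : OptimalityEq a l c1 c2 b p V) (hcf : CloudFirst p) (m : ℕ) (i1 : Fin 2)
    (k : ℕ) : V ⟨m, 0, i1, k + 1⟩ ≤ V ⟨m, 1, i1, k⟩ := by
  have ha := h.a_pos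
  have hl := h.l_pos
  have hlc := h.l_lt
  have hcc := h.c1_lt
  have hc1 : 0 < c1 := hl.trans hlc
  have hc2 : 0 < c2 := hc1.trans hcc
  have hb := h.b_pos
  refine h.compare (X := ℕ × Fin 2 × ℕ) (fun x => ⟨x.1, 0, x.2.1, x.2.2 + 1⟩)
    (fun x => ⟨x.1, 1, x.2.1, x.2.2⟩) ?_ (m, i1, k)
  clear m i1 k
  have hidle : ∀ B : ℝ, 0 ≤ B → ∀ (m : ℕ) (i1 : Fin 2) (k : ℕ), p ⟨m, 1, i1, k⟩ = Action.idle →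
      (∀ (m' : ℕ) (i1' : Fin 2) (k' : ℕ), m' + (i1' : ℕ) + (k' + 1) ≤ m + i1 + (k + 1) + 1 →
        V ⟨m', 0, i1', k' + 1⟩ - V ⟨m', 1, i1', k'⟩ ≤ B) →
      (b + (a + l + c1 + c2)) * (V ⟨m, 0, i1, k + 1⟩ - V ⟨m, 1, i1, k⟩)
        ≤ (a + l + c1 + c2) * B := by
    intro B hB m i1 k hp hy
    have hs := h.le_wait ⟨m, 0, i1, k + 1⟩
    have ht := h.idle_eq _ hp
    have ea := mul_le_mul_of_nonneg_left (hy (m + 1) i1 k (by omega)) ha.le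
    have ex := mul_le_mul_of_nonneg_left (hy m i1 k (by omega)) hc1.le
    have elB := mul_nonneg hl.le hB
    have ecB := mul_nonneg hc2.le hB
    cases k with
    | succ k =>
      have ec := mul_le_mul_of_nonneg_left (hy m i1 k (by omega)) hc2.le
      simp [react, arrive, State.jobs] at hs ht
      linarith
    | zero =>
      rcases fin_two_eq i1 with rfl | rfl
      · have hm : m = 0 := by
          by_contra hm
          rw [hcf _ (Nat.one_le_iff_ne_zero.mpr hm) rfl rfl] at hp
          cases hp
        subst hm
        simp [react, arrive, State.jobs] at hs ht ea ex
        have h4 : V ⟨0, 0, 0, 0⟩ ≤ V ⟨0, 1, 0, 0⟩ := h.mono ⟨le_rfl, by simp, le_rfl, le_rfl⟩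
        have e4 := mul_le_mul_of_nonneg_left h4 hc2.le
        linarith
      · simp [react, arrive, State.jobs] at hs ht ea ex
        -- The mode 2 tick on the left is split: a share `c1` is paired with the mode 1 completion
        -- on the right, and the surplus `c2 - c1` with no change there.
        have h4 : V ⟨m, 0, 1, 0⟩ ≤ V ⟨m, 1, 1, 0⟩ := h.mono ⟨le_rfl, by simp, le_rfl, le_rfl⟩
        have e4 := mul_le_mul_of_nonneg_left h4 (sub_nonneg.mpr hcc.le)
        have e5 := mul_le_mul_of_nonneg_left (h.sm1_le_sm2 hcf m) hc1.le
        linarith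
  rintro B hB ⟨m, i1, k⟩ hy
  simp only [State.jobs] at hy ⊢
  cases hp : p ⟨m, 1, i1, k⟩
  · exact hidle B hB m i1 k hp fun m' i1' k' hle => hy (m', i1', k') (by simp; omega)
  · have hadm := p.act_mem ⟨m, 1, i1, k⟩
    rw [hp] at hadm
    obtain ⟨hm, hi⟩ := hadm
    simp only at hm hi
    subst hi
    obtain ⟨m, rfl⟩ := Nat.exists_eq_succ_of_ne_zero (Nat.one_le_iff_ne_zero.mp hm)
    have h1 := hidle B hB m 1 k (act_full p m k) fun m' i1' k' hle =>
      hy (m', i1', k') (by simp at hle ⊢; omega)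
    have h2 := h.sm1_le m 0 (k + 1)
    have h3 := h.sm1_eq hp
    rw [Nat.succ_eq_add_one, h3]
    refine le_trans ?_ h1
    refine mul_le_mul_of_nonneg_left ?_ (by linarith)
    linarith
  · exact absurd hp (act_ne_SM2 p m i1 k)

end OptimalityEq

namespace OptimalityEq

variable {a l c1 c2 b : ℝ} {p : Policy} {V : State → ℝ}

theorem c1_pos (h : OptimalityEq a l c1 c2 b p V) : 0 < c1 := h.l_pos.trans h.l_lt

theorem c2_pos (h : OptimalityEq a l c1 c2 b p V) : 0 < c2 := h.c1_pos.trans h.c1_lt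

/-- Strictness arises at `k = 0`, where the surplus rate `c2 - c1` multiplies the gain of a whole
job; larger `k` inherit it through the `c2` tick. -/
theorem local_done_lt_of_sm1 (h : OptimalityEq a l c1 c2 b p V) (hcf : CloudFirst p) (m k : ℕ) :
    V ⟨m, 0, 1, k + 1⟩ < V ⟨m, 1, 1, k⟩ := by
  have ha := h.a_pos
  have hl := h.l_pos
  have hb := h.b_pos
  have hc1 := h.c1_pos
  have hc2 := h.c2_pos
  have ea := mul_le_mul_of_nonneg_left (h.local_done_le hcf (m + 1) 1 k) ha.le
  suffices hk : 0 < (b + a + l + c2) * (V ⟨m, 1, 1, k⟩ - V ⟨m, 0, 1, k + 1⟩) by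
    have := pos_of_mul_pos_right hk (by positivity)
    linarith
  have hs := h.le_wait ⟨m, 0, 1, k + 1⟩
  have ht := h.idle_eq _ (act_full p m k)
  induction k with
  | zero =>
    simp [react, arrive, State.jobs] at hs ht ea ⊢
    have h4 : V ⟨m, 0, 1, 0⟩ < V ⟨m, 1, 1, 0⟩ :=
      h.lt_of_jobs_lt ⟨le_rfl, by simp, le_rfl, le_rfl⟩ (by simp [State.jobs])
    have e4 := mul_lt_mul_of_pos_left h4 (sub_pos.mpr h.c1_lt)
    have e5 := mul_le_mul_of_nonneg_left (h.sm1_le_sm2 hcf m) hc1.le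
    linarith
  | succ k ih =>
    have ih' := ih (mul_le_mul_of_nonneg_left (h.local_done_le hcf (m + 1) 1 k) ha.le)
      (h.le_wait ⟨m, 0, 1, k + 1⟩) (h.idle_eq _ (act_full p m k))
    have e := mul_pos hc2 (pos_of_mul_pos_right ih' (by positivity))
    simp [react, arrive, State.jobs] at hs ht ea ⊢
    linarith

/-- Completing the local service is strictly beneficial. -/
theorem local_done_lt (h : OptimalityEq a l c1 c2 b p V) (hcf : CloudFirst p) (m : ℕ) (i1 : Fin 2)
    (k : ℕ) : V ⟨m, 0, i1, k + 1⟩ < V ⟨m, 1, i1, k⟩ := by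
  rcases fin_two_eq i1 with rfl | rfl
  swap
  · exact h.local_done_lt_of_sm1 hcf m k
  have ha := h.a_pos
  have hl := h.l_pos
  have hb := h.b_pos
  have hc1 := h.c1_pos
  have hc2 := h.c2_pos
  induction k generalizing m with
  | zero =>
    cases m with
    | succ m =>
      rw [h.sm1_eq (i2 := 1) (i1 := 0) (hcf _ (Nat.le_add_left 1 m) rfl rfl)]
      exact (h.sm1_le m 0 1).trans_lt (h.local_done_lt_of_sm1 hcf m 0)
    | zero =>
      have ea := mul_le_mul_of_nonneg_left (h.local_done_le hcf 1 0 0) ha.le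
      have hs := h.le_wait ⟨0, 0, 0, 1⟩
      have ht := h.idle_eq _ (act_empty p 1 0 0)
      have h4 : V ⟨0, 0, 0, 0⟩ < V ⟨0, 1, 0, 0⟩ :=
        h.lt_of_jobs_lt ⟨le_rfl, by simp, le_rfl, le_rfl⟩ (by simp [State.jobs])
      have e4 := mul_lt_mul_of_pos_left h4 hc2
      simp [react, arrive, State.jobs] at hs ht ea ⊢
      have hk : 0 < (b + a + l + c2) * (V ⟨0, 1, 0, 0⟩ - V ⟨0, 0, 0, 1⟩) := by linarith
      have := pos_of_mul_pos_right hk (by positivity)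
      linarith
  | succ k ih =>
    cases hp : p ⟨m, 1, 0, k + 1⟩
    · have ea := mul_le_mul_of_nonneg_left (h.local_done_le hcf (m + 1) 0 (k + 1)) ha.le
      have e4 := mul_lt_mul_of_pos_left (ih m) hc2
      have hs := h.le_wait ⟨m, 0, 0, k + 1 + 1⟩
      have ht := h.idle_eq _ hp
      simp [react, arrive, State.jobs] at hs ht ea ⊢
      have hk : 0 < (b + a + l + c2) * (V ⟨m, 1, 0, k + 1⟩ - V ⟨m, 0, 0, k + 1 + 1⟩) := by
        linarith
      have := pos_of_mul_pos_right hk (by positivity)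
      linarith
    · cases m with
      | zero =>
        rw [act_empty] at hp
        cases hp
      | succ m =>
        rw [h.sm1_eq hp]
        exact (h.sm1_le m 0 (k + 1 + 1)).trans_lt (h.local_done_lt_of_sm1 hcf m (k + 1))
    · exact absurd hp (act_ne_SM2 p m 0 (k + 1))

/-- At the cloud, a mode 2 job is preferable to a mode 1 job. -/
theorem cloud_sm2_le_sm1 (h : OptimalityEq a l c1 c2 b p V) (m : ℕ) (i2 : Fin 2) (k : ℕ) :
    V ⟨m, i2, 0, k + 1⟩ ≤ V ⟨m, i2, 1, k⟩ := by
  have ha := h.a_pos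
  have hl := h.l_pos
  have hb := h.b_pos
  have hc1 := h.c1_pos
  have hc2 := h.c2_pos
  refine h.compare (X := ℕ × Fin 2 × ℕ) (fun x => ⟨x.1, x.2.1, 0, x.2.2 + 1⟩)
    (fun x => ⟨x.1, x.2.1, 1, x.2.2⟩) ?_ (m, i2, k)
  clear m i2 k
  have hidle : ∀ B : ℝ, 0 ≤ B → ∀ (m : ℕ) (i2 : Fin 2) (k : ℕ), p ⟨m, i2, 1, k⟩ = Action.idle →
      (∀ (m' : ℕ) (i2' : Fin 2) (k' : ℕ), m' + (i2' : ℕ) + (k' + 1) ≤ m + i2 + (k + 1) + 1 →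
        V ⟨m', i2', 0, k' + 1⟩ - V ⟨m', i2', 1, k'⟩ ≤ B) →
      (b + (a + l + c1 + c2)) * (V ⟨m, i2, 0, k + 1⟩ - V ⟨m, i2, 1, k⟩)
        ≤ (a + l + c1 + c2) * B := by
    intro B hB m i2 k hp hy
    have hs := h.le_wait ⟨m, i2, 0, k + 1⟩
    have ht := h.idle_eq _ hp
    have ea := mul_le_mul_of_nonneg_left (hy (m + 1) i2 k (by omega)) ha.le
    have ex := mul_le_mul_of_nonneg_left (hy m i2 k (by omega)) hc1.le
    have el : l * V (react Event.tickL2 ⟨m, i2, 0, k + 1⟩)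
        - l * V (react Event.tickL2 ⟨m, i2, 1, k⟩) ≤ l * B := by
      rw [← mul_sub]
      refine mul_le_mul_of_nonneg_left ?_ hl.le
      rcases fin_two_eq i2 with rfl | rfl
      · simpa [react] using hy m 0 k (by omega)
      · simpa [react] using hy m 0 (k + 1) (by simp; omega)
    have ecB := mul_nonneg hc2.le hB
    cases k with
    | succ k =>
      have ec := mul_le_mul_of_nonneg_left (hy m i2 k (by omega)) hc2.le
      simp [react, arrive, State.jobs] at hs ht el
      linarith
    | zero =>
      simp [react, arrive, State.jobs] at hs ht ea ex el
      have h4 : V ⟨m, i2, 0, 0⟩ ≤ V ⟨m, i2, 1, 0⟩ := h.mono ⟨le_rfl, le_rfl, by simp, le_rfl⟩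
      have e4 := mul_le_mul_of_nonneg_left h4 (sub_nonneg.mpr h.c1_lt.le)
      linarith
  rintro B hB ⟨m, i2, k⟩ hy
  simp only [State.jobs] at hy ⊢
  cases hp : p ⟨m, i2, 1, k⟩
  · exact hidle B hB m i2 k hp fun m' i2' k' hle => hy (m', i2', k') (by simp; omega)
  · exact absurd hp (act_ne_SM1 p m i2 k)
  · cases m with
    | zero =>
      rw [act_empty] at hp
      cases hp
    | succ m =>
      rcases fin_two_eq i2 with rfl | rfl
      swap
      · exact absurd hp (act_ne_SM2 p _ 1 k)
      have h1 := hidle B hB m 1 k (act_full p m k) fun m' i2' k' hle =>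
        hy (m', i2', k') (by simp at hle ⊢; omega)
      have h2 := h.sm2_le m 0 (k + 1)
      rw [h.sm2_eq hp]
      refine le_trans ?_ h1
      refine mul_le_mul_of_nonneg_left ?_ (by positivity)
      linarith

/-- Under SM2 on the right this is `local_done_le`. Under idling with `k = 0`, cloud-first refills
the cloud after a `c1` tick, so both sides meet in `⟨m, 0, 1, 0⟩`. -/
theorem cloud_sm2_le_queued (h : OptimalityEq a l c1 c2 b p V) (hcf : CloudFirst p) (m k : ℕ) :
    V ⟨m, 0, 1, k + 1⟩ ≤ V ⟨m + 1, 0, 1, k⟩ := by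
  have ha := h.a_pos
  have hl := h.l_pos
  have hb := h.b_pos
  have hc1 := h.c1_pos
  have hc2 := h.c2_pos
  refine h.compare (X := ℕ × ℕ) (fun x => ⟨x.1, 0, 1, x.2 + 1⟩)
    (fun x => ⟨x.1 + 1, 0, 1, x.2⟩) ?_ (m, k)
  clear m k
  rintro B hB ⟨m, k⟩ hy
  simp only [State.jobs] at hy ⊢
  have hRB : 0 ≤ (a + l + c1 + c2) * B := by positivity
  cases hp : p ⟨m + 1, 0, 1, k⟩
  · have hs := h.le_wait ⟨m, 0, 1, k + 1⟩
    have ht := h.idle_eq _ hp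
    have ea := mul_le_mul_of_nonneg_left (hy (m + 1, k) (by simp; omega)) ha.le
    have ex := mul_le_mul_of_nonneg_left (hy (m, k) (by simp)) hc1.le
    have el := mul_le_mul_of_nonneg_left (hy (m, k) (by simp)) hl.le
    have ecB := mul_nonneg hc2.le hB
    cases k with
    | succ k =>
      have ec := mul_le_mul_of_nonneg_left (hy (m, k) (by simp; omega)) hc2.le
      simp [react, arrive, State.jobs] at hs ht ea ex el ec
      linarith
    | zero =>
      have h3 := h.sm1_eq (i2 := 0) (i1 := 0) (hcf ⟨m + 1, 0, 0, 0⟩ (Nat.le_add_left 1 m) rfl rfl)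
      have h4 : V ⟨m, 0, 1, 0⟩ ≤ V ⟨m + 1, 0, 1, 0⟩ := h.mono ⟨by simp, le_rfl, le_rfl, le_rfl⟩
      have e4 := mul_le_mul_of_nonneg_left h4 (sub_nonneg.mpr h.c1_lt.le)
      simp [react, arrive, State.jobs, h3] at hs ht ea ex el
      linarith
  · exact absurd hp (act_ne_SM1 p _ 0 k)
  · rw [h.sm2_eq hp]
    refine le_trans ?_ hRB
    refine mul_nonpos_of_nonneg_of_nonpos (by positivity) ?_
    linarith [h.local_done_le hcf m 1 k]

/-- Only arrivals and `c2` ticks act on these states, and the arrival difference is nonnegative. The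
absence of `l` from the factor keeps this difference from decaying faster than the loss of SM2 in
`exists_sm2_of_succ`. -/
theorem queued_sub_recursion (h : OptimalityEq a l c1 c2 b p V) (hcf : CloudFirst p) {m k : ℕ}
    (hp : p ⟨m + 1, 0, 1, k + 1⟩ = Action.idle) :
    c2 * (V ⟨m + 1, 0, 1, k⟩ - V ⟨m, 0, 1, k + 1⟩)
      ≤ (b + a + c2) * (V ⟨m + 1, 0, 1, k + 1⟩ - V ⟨m, 0, 1, k + 1 + 1⟩) := by
  have ea := mul_le_mul_of_nonneg_left (h.cloud_sm2_le_queued hcf (m + 1) (k + 1)) h.a_pos.le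
  have hs := h.le_wait ⟨m, 0, 1, k + 1 + 1⟩
  have ht := h.idle_eq _ hp
  simp [react, arrive, State.jobs] at hs ht ea
  linarith

/-- The surplus rate `c2 - c1` times the bound of `one_le_of_jobs_lt`. Uniformity in `m` is what
`exists_sm2` needs. -/
theorem queued_sub_zero (h : OptimalityEq a l c1 c2 b p V) (hcf : CloudFirst p) {m : ℕ}
    (hp : p ⟨m + 1, 0, 1, 0⟩ = Action.idle) :
    (c2 - c1) / (b + (a + l + c1 + c2)) ≤
      (b + a + c2) * (V ⟨m + 1, 0, 1, 0⟩ - V ⟨m, 0, 1, 1⟩) := by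
  have ha := h.a_pos
  have hl := h.l_pos
  have hb := h.b_pos
  have hc1 := h.c1_pos
  have hc2 := h.c2_pos
  have ea := mul_le_mul_of_nonneg_left (h.cloud_sm2_le_queued hcf (m + 1) 0) ha.le
  have hs := h.le_wait ⟨m, 0, 1, 1⟩
  have ht := h.idle_eq _ hp
  have h3 := h.sm1_eq (i2 := 0) (i1 := 0) (hcf ⟨m + 1, 0, 0, 0⟩ (Nat.le_add_left 1 m) rfl rfl)
  have h4 := h.one_le_of_jobs_lt (s := ⟨m, 0, 1, 0⟩) (t := ⟨m + 1, 0, 1, 0⟩)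
    ⟨by simp, le_rfl, le_rfl, le_rfl⟩ (by simp [State.jobs])
  have h5 : (c2 - c1) / (b + (a + l + c1 + c2)) ≤
      (c2 - c1) * (V ⟨m + 1, 0, 1, 0⟩ - V ⟨m, 0, 1, 0⟩) := by
    rw [div_le_iff₀ (by positivity)]
    have := mul_le_mul_of_nonneg_left h4 (sub_nonneg.mpr h.c1_lt.le)
    linarith
  simp [react, arrive, State.jobs, h3] at hs ht ea
  linarith

theorem cloud_sm2_lt_queued (h : OptimalityEq a l c1 c2 b p V) (hcf : CloudFirst p) (m k : ℕ) :
    V ⟨m, 0, 1, k + 1⟩ < V ⟨m + 1, 0, 1, k⟩ := by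
  have ha := h.a_pos
  have hl := h.l_pos
  have hb := h.b_pos
  have hc1 := h.c1_pos
  have hc2 := h.c2_pos
  have hcc := sub_pos.mpr h.c1_lt
  induction k with
  | zero =>
    cases hp : p ⟨m + 1, 0, 1, 0⟩
    · have hk := lt_of_lt_of_le (by positivity) (h.queued_sub_zero hcf hp)
      exact sub_pos.mp (pos_of_mul_pos_right hk (by positivity))
    · exact absurd hp (act_ne_SM1 p _ 0 0)
    · rw [h.sm2_eq hp]
      exact h.local_done_lt hcf m 1 0
  | succ k ih =>
    cases hp : p ⟨m + 1, 0, 1, k + 1⟩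
    · have hk := lt_of_lt_of_le (mul_pos hc2 (sub_pos.mpr ih)) (h.queued_sub_recursion hcf hp)
      exact sub_pos.mp (pos_of_mul_pos_right hk (by positivity))
    · exact absurd hp (act_ne_SM1 p _ 0 (k + 1))
    · rw [h.sm2_eq hp]
      exact h.local_done_lt hcf m 1 (k + 1)

theorem single_cloud_recursion (h : OptimalityEq a l c1 c2 b p V) (k : ℕ) :
    c2 * (V ⟨0, 0, 1, k⟩ - V ⟨0, 0, 0, k + 1⟩)
      ≤ (b + a + c2) * (V ⟨0, 0, 1, k + 1⟩ - V ⟨0, 0, 0, k + 1 + 1⟩) := by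
  have ea := mul_le_mul_of_nonneg_left (h.cloud_sm2_le_sm1 1 0 (k + 1)) h.a_pos.le
  have hs := h.le_wait ⟨0, 0, 0, k + 1 + 1⟩
  have ht := h.idle_eq _ (act_empty p 0 1 (k + 1))
  simp [react, arrive, State.jobs] at hs ht ea
  linarith

theorem single_cloud_lt (h : OptimalityEq a l c1 c2 b p V) (k : ℕ) :
    V ⟨0, 0, 0, k + 1⟩ < V ⟨0, 0, 1, k⟩ := by
  have ha := h.a_pos
  have hb := h.b_pos
  have hc2 := h.c2_pos
  suffices hk : 0 < (b + a + c2) * (V ⟨0, 0, 1, k⟩ - V ⟨0, 0, 0, k + 1⟩) by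
    have := pos_of_mul_pos_right hk (by positivity)
    linarith
  induction k with
  | zero =>
    have ea := mul_le_mul_of_nonneg_left (h.cloud_sm2_le_sm1 1 0 0) ha.le
    have hs := h.le_wait ⟨0, 0, 0, 1⟩
    have ht := h.idle_eq _ (act_empty p 0 1 0)
    have h4 : V ⟨0, 0, 0, 0⟩ < V ⟨0, 0, 1, 0⟩ :=
      h.lt_of_jobs_lt ⟨le_rfl, le_rfl, by simp, le_rfl⟩ (by simp [State.jobs])
    have e4 := mul_lt_mul_of_pos_left h4 (sub_pos.mpr h.c1_lt)
    simp [react, arrive, State.jobs] at hs ht ea ⊢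
    linarith
  | succ k ih =>
    exact lt_of_lt_of_le (mul_pos hc2 (pos_of_mul_pos_right ih (by positivity)))
      (h.single_cloud_recursion k)

end OptimalityEq

/-! ### When mode 2 is chosen -/

/-- A sequence that contracts at rate `c / A` and is pushed down by a sequence decaying at the
slower rate `c / B` becomes negative. -/
theorem exists_neg_of_recursion {A B c l : ℝ} (hB : 0 < B) (hBA : B ≤ A) (hc : 0 < c) (hl : 0 < l)
    {x y : ℕ → ℝ} (hy0 : 0 < y 0) (hy : ∀ j, c * y j ≤ B * y (j + 1))
    (hx : ∀ j, A * x (j + 1) ≤ c * x j - l * y (j + 1)) : ∃ j, x j < 0 := by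
  have hA : 0 < A := hB.trans_le hBA
  have hypow : ∀ j, (c / A) ^ j * y 0 ≤ y j := by
    intro j
    induction j with
    | zero => simp
    | succ j ih =>
      have h0 : 0 ≤ y j := le_trans (by positivity) ih
      have hy' : c / B * y j ≤ y (j + 1) := by
        rw [div_mul_eq_mul_div, div_le_iff₀' hB]
        exact hy j
      calc (c / A) ^ (j + 1) * y 0 = c / A * ((c / A) ^ j * y 0) := by rw [pow_succ]; ring
        _ ≤ c / A * y j := by gcongr
        _ ≤ c / B * y j := by gcongr
        _ ≤ _ := hy'
  -- With `y` bounded below by the same power `(c / A) ^ j`, every step contributes an equal push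
  -- after rescaling, which yields the factor `j`.
  have hxpow : ∀ j : ℕ, x j ≤ (c / A) ^ j * (x 0 - j * (l / A * y 0)) := by
    intro j
    induction j with
    | zero => simp
    | succ j ih =>
      have h1 : x (j + 1) ≤ c / A * x j - l / A * y (j + 1) := by
        have := hx j
        rw [← le_div_iff₀' hA] at this
        calc _ ≤ _ := this
          _ = _ := by ring
      have h2 : c / A * x j ≤ c / A * ((c / A) ^ j * (x 0 - j * (l / A * y 0))) := by gcongr
      have h3 : l / A * ((c / A) ^ (j + 1) * y 0) ≤ l / A * y (j + 1) := by
        gcongr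
        exact hypow (j + 1)
      calc x (j + 1) ≤ c / A * ((c / A) ^ j * (x 0 - j * (l / A * y 0)))
            - l / A * ((c / A) ^ (j + 1) * y 0) := by linarith
        _ = _ := by rw [pow_succ]; push_cast; ring
  have hκ : 0 < l / A * y 0 := by positivity
  obtain ⟨j, hj⟩ := exists_nat_gt (x 0 / (l / A * y 0))
  rw [div_lt_iff₀ hκ] at hj
  refine ⟨j, (hxpow j).trans_lt (mul_neg_of_pos_of_neg (by positivity) (by linarith))⟩

theorem act_mono_of_urgencyMonotone {p : Policy} (hum : UrgencyMonotone p) {i2 i1 : Fin 2}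
    {k m m' : ℕ} (hm : m ≤ m') (h : p ⟨m, i2, i1, k⟩ ≠ Action.idle) :
    p ⟨m', i2, i1, k⟩ ≠ Action.idle := by
  induction m', hm using Nat.le_induction with
  | base => exact h
  | succ m' _ ih => exact fun h2 => ih (hum ⟨m', i2, i1, k⟩ h2)

theorem eq_SM2_of_ne {x : Action} (h0 : x ≠ Action.idle) (h1 : x ≠ Action.SM1) :
    x = Action.SM2 := by
  cases x <;> simp_all

namespace OptimalityEq

variable {a l c1 c2 b : ℝ} {p : Policy} {V : State → ℝ}

/-- If mode 2 is optimal with `k` mode 2 jobs at the cloud and any larger base queue, then it is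
chosen with `k + 1` such jobs, unless mode 1 is. -/
theorem sm2_of_sm2_optimal (h : OptimalityEq a l c1 c2 b p V) (hcf : CloudFirst p) {m : ℕ}
    {i1 : Fin 2} {k : ℕ}
    (hk : ∀ m', m ≤ m' → V ⟨m' + 1, 0, i1, k⟩ = V ⟨m', 1, i1, k⟩)
    (hne : ∀ m', m ≤ m' → p ⟨m' + 1, 0, i1, k + 1⟩ ≠ Action.SM1) :
    p ⟨m + 1, 0, i1, k + 1⟩ = Action.SM2 := by
  have ha := h.a_pos
  have hl := h.l_pos
  have hb := h.b_pos
  have hc1 := h.c1_pos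
  have hc2 := h.c2_pos
  by_contra hcon
  set D : ℕ → ℝ := fun j => V ⟨m + j, 1, i1, k + 1⟩ - V ⟨m + j + 1, 0, i1, k + 1⟩ with hD
  have hD0 : ∀ j, 0 ≤ D j := fun j => sub_nonneg.mpr (h.sm2_le (m + j) i1 (k + 1))
  -- The `c2` terms cancel by `hk`, and the local tick contributes strictly less than `l * D j`.
  have hstep : ∀ j, p ⟨m + j + 1, 0, i1, k + 1⟩ = Action.idle →
      (b + a + c2) * D j < a * D (j + 1) := by
    intro j hp
    have hs := h.le_wait ⟨m + j, 1, i1, k + 1⟩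
    have ht := h.idle_eq _ hp
    have e := mul_lt_mul_of_pos_left (h.local_done_lt hcf (m + j) i1 (k + 1)) hl
    have h3 := hk (m + j) (Nat.le_add_right m j)
    simp [react, arrive, State.jobs, h3] at hs ht
    simp only [hD, ← add_assoc]
    linarith
  have hidle : ∀ j, p ⟨m + j + 1, 0, i1, k + 1⟩ = Action.idle := by
    intro j
    induction j with
    | zero =>
      by_contra h0
      exact hcon (eq_SM2_of_ne h0 (hne m le_rfl))
    | succ j ih =>
      by_contra h0
      have h1 := eq_SM2_of_ne h0 (hne (m + (j + 1)) (Nat.le_add_right _ _))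
      have h2 : D (j + 1) = 0 := by
        simp only [hD]
        rw [h.sm2_eq h1, sub_self]
      have h3 := hstep j ih
      have h4 := mul_nonneg (show 0 ≤ b + a + c2 by positivity) (hD0 j)
      rw [h2] at h3
      linarith
  obtain ⟨C, hC0, hC⟩ := h.growth
  have hle := nonpos_of_discounted_step ha.le hb D
    (fun j => (⟨m + j, 1, i1, k + 1⟩ : State).jobs)
    ⟨C, fun j => by
      have := hC ⟨m + j, 1, i1, k + 1⟩
      have := h.nonneg ⟨m + j + 1, 0, i1, k + 1⟩
      simp only [hD]
      linarith⟩
    (by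
      intro C L hC hL hd j
      have h1 := (hstep j (hidle j)).le
      have h2 := mul_le_mul_of_nonneg_left (hd (j + 1)) ha.le
      have h3 : (((⟨m + (j + 1), 1, i1, k + 1⟩ : State).jobs : ℕ) : ℝ)
          = ((⟨m + j, 1, i1, k + 1⟩ : State).jobs : ℝ) + 1 := by
        simp only [State.jobs]
        push_cast
        ring
      rw [h3] at h2
      have h4 := mul_nonneg hc2.le (hD0 j)
      linarith) 1
  have h1 := hstep 0 (hidle 0)
  have h2 := mul_nonneg (show 0 ≤ b + a + c2 by positivity) (hD0 0)
  have h3 := mul_nonpos_of_nonneg_of_nonpos ha.le hle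
  simp only [zero_add] at h1
  linarith

theorem sm2_mono_queue (hum : UrgencyMonotone p) {m m' k : ℕ} (hm : m ≤ m')
    (hp : p ⟨m, 0, 1, k⟩ = Action.SM2) : p ⟨m', 0, 1, k⟩ = Action.SM2 :=
  eq_SM2_of_ne (act_mono_of_urgencyMonotone hum hm (by rw [hp]; simp)) (act_ne_SM1 p _ 0 k)

theorem sm2_mono (h : OptimalityEq a l c1 c2 b p V) (hcf : CloudFirst p) (hum : UrgencyMonotone p)
    {m m' k k' : ℕ} (hm : m ≤ m') (hk : k ≤ k') (hp : p ⟨m, 0, 1, k⟩ = Action.SM2) :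
    p ⟨m', 0, 1, k'⟩ = Action.SM2 := by
  refine sm2_mono_queue hum hm ?_
  induction k', hk using Nat.le_induction with
  | base => exact hp
  | succ k' _ ih =>
    cases m with
    | zero => rw [act_empty] at hp; cases hp
    | succ m =>
      exact h.sm2_of_sm2_optimal hcf
        (fun m' hm' => h.sm2_eq (sm2_mono_queue hum (Nat.succ_le_succ hm') ih))
        (fun m' _ => act_ne_SM1 p _ 0 _)

/-- With one mode 1 job at the cloud, mode 2 is chosen when the base queue is long enough. -/
theorem exists_sm2 (h : OptimalityEq a l c1 c2 b p V) (hcf : CloudFirst p) :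
    ∃ m, p ⟨m + 1, 0, 1, 0⟩ = Action.SM2 := by
  have ha := h.a_pos
  have hl := h.l_pos
  have hb := h.b_pos
  have hc1 := h.c1_pos
  have hc2 := h.c2_pos
  have hcc := sub_pos.mpr h.c1_lt
  by_contra! hcon
  have hidle : ∀ m, p ⟨m + 1, 0, 1, 0⟩ = Action.idle := by
    intro m
    by_contra h0
    exact hcon m (eq_SM2_of_ne h0 (act_ne_SM1 p _ 0 0))
  set η : ℝ := (c2 - c1) / (b + (a + l + c1 + c2)) / (b + a + c2) with hη
  have hη0 : 0 < η := by positivity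
  have hH : ∀ m, η ≤ V ⟨m + 1, 0, 1, 0⟩ - V ⟨m, 0, 1, 1⟩ := by
    intro m
    rw [hη, div_le_iff₀' (by positivity)]
    exact h.queued_sub_zero hcf (hidle m)
  set D : ℕ → ℝ := fun m => V ⟨m, 1, 1, 0⟩ - V ⟨m + 1, 0, 1, 0⟩ with hD
  have hD0 : ∀ m, 0 ≤ D m := fun m => sub_nonneg.mpr (h.sm2_le m 1 0)
  -- Cloud-first refills the cloud after a `c1` tick, so that tick shortens the base queue by one on
  -- both sides.
  have hstep : ∀ m, (b + a + l + c1) * D (m + 1) ≤ a * D (m + 2) - l * η + c1 * D m := by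
    intro m
    have hs := h.le_wait ⟨m + 1, 1, 1, 0⟩
    have ht := h.idle_eq _ (hidle (m + 1))
    have h3 := h.sm1_eq (hcf ⟨m + 1, 1, 0, 0⟩ (Nat.le_add_left 1 m) rfl rfl)
    have h4 := h.sm1_eq (hcf ⟨m + 1 + 1, 0, 0, 0⟩ (Nat.le_add_left 1 _) rfl rfl)
    have e := mul_le_mul_of_nonneg_left (hH (m + 1)) hl.le
    simp [react, arrive, State.jobs, h3, h4] at hs ht
    simp only [hD]
    linarith
  -- The constant `-q` solves the recursion with equality, and `C0 * θ ^ m` is a decaying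
  -- supersolution of its homogeneous part, matched at `m = 0`. Hence `D m ≤ C0 * θ ^ m - q`, which
  -- becomes negative.
  set q : ℝ := l * η / (b + l) with hq
  have hq0 : 0 < q := by positivity
  have hqe : (b + l) * q = l * η := by rw [hq]; field_simp
  set θ : ℝ := (a + c1) / (b + a + l + c1) with hθ
  have hθ0 : 0 < θ := by positivity
  have hθ1 : θ < 1 := by rw [hθ, div_lt_one (by positivity)]; linarith
  have hθe : (b + a + l + c1) * θ = a + c1 := by rw [hθ]; field_simp
  set C0 : ℝ := D 0 + q with hC0
  have hC0' : 0 ≤ C0 := add_nonneg (hD0 0) hq0.le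
  obtain ⟨C, _, hC⟩ := h.growth
  have hle := nonpos_of_discounted_step (R := a + c1) (b := b + l) (by positivity) (by positivity)
    (fun m => D m + q - C0 * θ ^ m) (fun m => m + 2)
    ⟨C + q, fun m => by
      have h1 := hC ⟨m, 1, 1, 0⟩
      have h2 := h.nonneg ⟨m + 1, 0, 1, 0⟩
      have h3 : 0 ≤ C0 * θ ^ m := by positivity
      simp [State.jobs] at h1
      simp only [hD]
      push_cast
      have h4 : 0 ≤ q * (m + 2) := by positivity
      linarith⟩
    (by
      intro C L hC hL hd m
      cases m with
      | zero =>
        rw [pow_zero, mul_one, hC0, sub_self, mul_zero]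
        positivity
      | succ m =>
        have e1 := mul_le_mul_of_nonneg_left (hd (m + 2)) ha.le
        have e2 := mul_le_mul_of_nonneg_left (hd m) hc1.le
        have e3 := hstep m
        have e4 : a * (C0 * θ ^ (m + 2)) + c1 * (C0 * θ ^ m)
            ≤ (b + a + l + c1) * (C0 * θ ^ (m + 1)) := by
          have h1 : θ ^ (m + 2) ≤ θ ^ m :=
            pow_le_pow_of_le_one hθ0.le hθ1.le (Nat.le_add_right _ _)
          calc _ ≤ a * (C0 * θ ^ m) + c1 * (C0 * θ ^ m) := by gcongr
            _ = C0 * θ ^ m * (a + c1) := by ring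
            _ = C0 * θ ^ m * ((b + a + l + c1) * θ) := by rw [hθe]
            _ = _ := by rw [pow_succ]; ring
        have e5 : 0 ≤ c1 * (C * 2) := by positivity
        push_cast at e1 e2 ⊢
        linarith)
  have hlim : Filter.Tendsto (fun m : ℕ => C0 * θ ^ m - q) Filter.atTop (nhds (C0 * 0 - q)) :=
    ((tendsto_pow_atTop_nhds_zero_of_lt_one hθ0.le hθ1).const_mul _).sub_const _
  have := ge_of_tendsto' hlim fun m => by
    have h1 := hle m
    have h2 := hD0 m
    show (0 : ℝ) ≤ _
    linarith
  linarith

/-- Descent in the base queue. As SM2 is chosen with one more job, the arrival terms cancel; idling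
for all `k` would then drive the loss of SM2 below zero by `exists_neg_of_recursion`. -/
theorem exists_sm2_of_succ (h : OptimalityEq a l c1 c2 b p V) (hcf : CloudFirst p) {m k0 : ℕ}
    (hp : ∀ k, k0 ≤ k → p ⟨m + 2, 0, 1, k⟩ = Action.SM2) :
    ∃ k, p ⟨m + 1, 0, 1, k⟩ = Action.SM2 := by
  have ha := h.a_pos
  have hl := h.l_pos
  have hb := h.b_pos
  have hc1 := h.c1_pos
  have hc2 := h.c2_pos
  by_contra! hcon
  have hidle : ∀ k, p ⟨m + 1, 0, 1, k⟩ = Action.idle := by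
    intro k
    by_contra h0
    exact hcon k (eq_SM2_of_ne h0 (act_ne_SM1 p _ 0 k))
  obtain ⟨j, hj⟩ := exists_neg_of_recursion (A := b + a + l + c2) (B := b + a + c2) (c := c2)
    (l := l) (by positivity) (by linarith) hc2 hl
    (x := fun j => V ⟨m, 1, 1, k0 + j⟩ - V ⟨m + 1, 0, 1, k0 + j⟩)
    (y := fun j => V ⟨m + 1, 0, 1, k0 + j⟩ - V ⟨m, 0, 1, k0 + j + 1⟩)
    (sub_pos.mpr (h.cloud_sm2_lt_queued hcf m _))
    (fun j => h.queued_sub_recursion hcf (hidle _))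
    (by
      intro j
      have hs := h.le_wait ⟨m, 1, 1, k0 + j + 1⟩
      have ht := h.idle_eq _ (hidle (k0 + j + 1))
      have h3 := h.sm2_eq (hp (k0 + j + 1) (by omega))
      simp [react, arrive, State.jobs, h3] at hs ht
      simp only [← add_assoc]
      linarith)
  linarith [h.sm2_le m 1 (k0 + j)]

/-- With one mode 1 job and many mode 2 jobs at the cloud, mode 2 is chosen for any nonempty base
queue. -/
theorem exists_forall_sm2 (h : OptimalityEq a l c1 c2 b p V) (hcf : CloudFirst p)
    (hum : UrgencyMonotone p) :
    ∃ k0, ∀ m k, k0 ≤ k → p ⟨m + 1, 0, 1, k⟩ = Action.SM2 := by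
  have key : ∀ m k, p ⟨m + 1, 0, 1, k⟩ = Action.SM2 → ∃ k0, p ⟨1, 0, 1, k0⟩ = Action.SM2 := by
    intro m
    induction m with
    | zero => exact fun k hk => ⟨k, hk⟩
    | succ m ih =>
      intro k hk
      obtain ⟨k', hk'⟩ := h.exists_sm2_of_succ hcf (m := m) (k0 := k)
        fun k' hk' => h.sm2_mono hcf hum le_rfl hk' hk
      exact ih k' hk'
  obtain ⟨m, hm⟩ := h.exists_sm2 hcf
  obtain ⟨k0, hk0⟩ := key m 0 hm
  exact ⟨k0, fun m k hk => h.sm2_mono hcf hum (Nat.le_add_left 1 m) hk hk0⟩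

/-- A mode 1 job waits behind all `k` mode 2 jobs, while the local server can work meanwhile.
`exists_forall_sm2` controls the arrival term; once the difference is negative, the recursion keeps
it so. -/
theorem exists_forall_single_lt (h : OptimalityEq a l c1 c2 b p V) (hcf : CloudFirst p)
    (hum : UrgencyMonotone p) :
    ∃ k0, ∀ k, k0 ≤ k → V ⟨0, 1, 0, k⟩ < V ⟨0, 0, 1, k⟩ := by
  have ha := h.a_pos
  have hl := h.l_pos
  have hb := h.b_pos
  have hc1 := h.c1_pos
  have hc2 := h.c2_pos
  obtain ⟨k0, hk0⟩ := h.exists_forall_sm2 hcf hum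
  have hrec : ∀ k, k0 ≤ k → (b + a + l + c2) * (V ⟨0, 1, 0, k + 1⟩ - V ⟨0, 0, 1, k + 1⟩) ≤
      c2 * (V ⟨0, 1, 0, k⟩ - V ⟨0, 0, 1, k⟩) - l * (V ⟨0, 0, 1, k + 1⟩ - V ⟨0, 0, 0, k + 1 + 1⟩) := by
    intro k hk
    have hs := h.le_wait ⟨0, 1, 0, k + 1⟩
    have ht := h.idle_eq _ (act_empty p 0 1 (k + 1))
    have h3 := h.sm2_eq (hk0 0 (k + 1) (by omega))
    have e := mul_le_mul_of_nonneg_left (h.sm1_le 0 1 (k + 1)) ha.le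
    simp [react, arrive, State.jobs] at hs ht h3 e
    rw [h3] at ht
    linarith
  obtain ⟨j, hj⟩ := exists_neg_of_recursion (A := b + a + l + c2) (B := b + a + c2) (c := c2)
    (l := l) (by positivity) (by linarith) hc2 hl
    (x := fun j => V ⟨0, 1, 0, k0 + j⟩ - V ⟨0, 0, 1, k0 + j⟩)
    (y := fun j => V ⟨0, 0, 1, k0 + j⟩ - V ⟨0, 0, 0, k0 + j + 1⟩)
    (sub_pos.mpr (h.single_cloud_lt _)) (fun j => h.single_cloud_recursion _)
    (fun j => hrec (k0 + j) (Nat.le_add_right _ _))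
  refine ⟨k0 + j, fun k hk => ?_⟩
  induction k, hk using Nat.le_induction with
  | base => exact sub_neg.mp hj
  | succ k hk ih =>
    have h1 := hrec k (le_trans (Nat.le_add_right _ _) hk)
    have h2 := mul_pos hl (sub_pos.mpr (h.single_cloud_lt (k + 1)))
    have h3 := mul_pos hc2 (sub_pos.mpr ih)
    have h4 : 0 < (b + a + l + c2) * (V ⟨0, 0, 1, k + 1⟩ - V ⟨0, 1, 0, k + 1⟩) := by linarith
    exact sub_pos.mp (pos_of_mul_pos_right h4 (by positivity))

section Tie

/-! Propagation of ties between sending a job to the cloud in mode 1 and keeping it queued. -/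

/-- A tie forces the weighted sum of the differences after each event to be nonpositive. All of them
are nonnegative, so each vanishes, in particular the one after the local tick. -/
theorem tie_of_busy (h : OptimalityEq a l c1 c2 b p V) {m k : ℕ}
    (ht : V ⟨m, 1, 1, k + 1⟩ = V ⟨m + 1, 1, 0, k + 1⟩) :
    V ⟨m, 0, 1, k + 1 + 1⟩ = V ⟨m + 1, 0, 0, k + 1 + 1⟩ := by
  have e1 := mul_le_mul_of_nonneg_left (h.sm1_le (m + 1) 1 (k + 1)) h.a_pos.le
  have e2 := mul_le_mul_of_nonneg_left (h.sm1_le m 1 k) h.c2_pos.le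
  have hs := h.le_wait ⟨m + 1, 1, 0, k + 1⟩
  have hi := h.idle_eq _ (act_full p m (k + 1))
  simp [react, arrive, State.jobs] at hs hi
  rw [ht] at hi
  refine le_antisymm (le_of_mul_le_mul_left ?_ h.l_pos) (h.sm1_le m 0 _)
  linarith

theorem tie_arrival (h : OptimalityEq a l c1 c2 b p V) {m k : ℕ}
    (hp : p ⟨m, 0, 1, k + 1⟩ = Action.idle)
    (ht : V ⟨m, 0, 1, k + 1⟩ = V ⟨m + 1, 0, 0, k + 1⟩) :
    V ⟨m + 1, 0, 1, k + 1⟩ = V ⟨m + 1 + 1, 0, 0, k + 1⟩ := by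
  have e2 := mul_le_mul_of_nonneg_left (h.sm1_le m 0 k) h.c2_pos.le
  have hs := h.le_wait ⟨m + 1, 0, 0, k + 1⟩
  have hi := h.idle_eq _ hp
  simp [react, arrive, State.jobs] at hs hi
  rw [ht] at hi
  refine le_antisymm (le_of_mul_le_mul_left ?_ h.a_pos) (h.sm1_le (m + 1) 0 _)
  linarith

/-- SM2 on the left is also available on the right, so the tie passes to the states with a busy
local server. -/
theorem tie_descend (h : OptimalityEq a l c1 c2 b p V) {m k : ℕ}
    (hp : p ⟨m + 1, 0, 1, k + 1⟩ = Action.SM2)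
    (ht : V ⟨m + 1, 0, 1, k + 1⟩ = V ⟨m + 1 + 1, 0, 0, k + 1⟩) :
    V ⟨m, 0, 1, k + 1 + 1⟩ = V ⟨m + 1, 0, 0, k + 1 + 1⟩ := by
  refine h.tie_of_busy (le_antisymm ?_ (h.sm1_le m 1 _))
  rw [← h.sm2_eq hp, ht]
  exact h.sm2_le (m + 1) 0 (k + 1)

/-- While the policy idles, arrivals carry the tie to longer base queues. By `exists_sm2` this ends
with SM2, and there the tie descends. -/
theorem tie_succ (h : OptimalityEq a l c1 c2 b p V) (hcf : CloudFirst p) (hum : UrgencyMonotone p)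
    {m k : ℕ} (ht : V ⟨m, 0, 1, k + 1⟩ = V ⟨m + 1, 0, 0, k + 1⟩) :
    ∃ m', V ⟨m', 0, 1, k + 1 + 1⟩ = V ⟨m' + 1, 0, 0, k + 1 + 1⟩ := by
  obtain ⟨M, hM⟩ := h.exists_sm2 hcf
  have key : ∀ d m, M + 1 ≤ m + d → V ⟨m, 0, 1, k + 1⟩ = V ⟨m + 1, 0, 0, k + 1⟩ →
      ∃ m', V ⟨m', 0, 1, k + 1 + 1⟩ = V ⟨m' + 1, 0, 0, k + 1 + 1⟩ := by
    intro d
    induction d with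
    | zero =>
      intro m hm ht
      obtain ⟨m, rfl⟩ := Nat.exists_eq_succ_of_ne_zero (show m ≠ 0 by omega)
      exact ⟨m, h.tie_descend (h.sm2_mono hcf hum hm (Nat.zero_le _) hM) ht⟩
    | succ d ih =>
      intro m hm ht
      cases hp : p ⟨m, 0, 1, k + 1⟩
      · exact ih (m + 1) (by omega) (h.tie_arrival hp ht)
      · exact absurd hp (act_ne_SM1 p _ 0 _)
      · cases m with
        | zero => rw [act_empty] at hp; cases hp
        | succ m => exact ⟨m, h.tie_descend hp ht⟩
  exact key (M + 1) m (by omega) ht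

/-- While the cloud serves a mode 2 job, sending a job there in mode 1 is strictly suboptimal. -/
theorem sm1_lt (h : OptimalityEq a l c1 c2 b p V) (hcf : CloudFirst p) (hum : UrgencyMonotone p)
    (m k : ℕ) : V ⟨m + 1, 0, 0, k + 1⟩ < V ⟨m, 0, 1, k + 1⟩ := by
  refine lt_of_le_of_ne (h.sm1_le m 0 _) fun hne => ?_
  obtain ⟨k0, hk0⟩ := h.exists_forall_sm2 hcf hum
  obtain ⟨k1, hk1⟩ := h.exists_forall_single_lt hcf hum
  have hup : ∀ d, ∃ m', V ⟨m', 0, 1, k + d + 1⟩ = V ⟨m' + 1, 0, 0, k + d + 1⟩ := by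
    intro d
    induction d with
    | zero => exact ⟨m, hne.symm⟩
    | succ d ih =>
      obtain ⟨m', hm'⟩ := ih
      exact h.tie_succ hcf hum hm'
  -- Each descent trades one queued job for one more mode 2 job, so the bounds on `k` persist until
  -- the base queue is empty.
  have hdown : ∀ m k, k0 ≤ k → k1 ≤ k → V ⟨m, 0, 1, k + 1⟩ ≠ V ⟨m + 1, 0, 0, k + 1⟩ := by
    intro m
    induction m with
    | zero =>
      intro k _ h1 ht
      have := hk1 (k + 1) (by omega)
      rw [ht] at this
      exact absurd (h.sm2_le 0 0 (k + 1)) (not_le.mpr this)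
    | succ m ih =>
      intro k h0 h1 ht
      exact ih (k + 1) (by omega) (by omega) (h.tie_descend (hk0 m (k + 1) (by omega)) ht)
  obtain ⟨m', hm'⟩ := hup (k0 + k1)
  exact hdown m' _ (by omega) (by omega) hm'

end Tie

/-! ### Switch structure and thresholds -/

theorem act_ne_SM1_of_cloud_busy (h : OptimalityEq a l c1 c2 b p V) (hcf : CloudFirst p)
    (hum : UrgencyMonotone p) (m k : ℕ) : p ⟨m, 0, 0, k + 1⟩ ≠ Action.SM1 := by
  intro hp
  cases m with
  | zero => rw [act_empty] at hp; cases hp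
  | succ m =>
    have := h.sm1_lt hcf hum m k
    rw [h.sm1_eq hp] at this
    exact lt_irrefl _ this

theorem sm2_mono_queue_of_no_sm1 (h : OptimalityEq a l c1 c2 b p V) (hcf : CloudFirst p)
    (hum : UrgencyMonotone p) {m m' k : ℕ} (hm : m ≤ m')
    (hp : p ⟨m, 0, 0, k + 1⟩ = Action.SM2) : p ⟨m', 0, 0, k + 1⟩ = Action.SM2 :=
  eq_SM2_of_ne (act_mono_of_urgencyMonotone hum hm (by rw [hp]; simp))
    (h.act_ne_SM1_of_cloud_busy hcf hum _ _)

theorem sm2_mono_of_no_sm1 (h : OptimalityEq a l c1 c2 b p V) (hcf : CloudFirst p)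
    (hum : UrgencyMonotone p) {m m' k k' : ℕ} (hm : m ≤ m') (hk : k ≤ k')
    (hp : p ⟨m, 0, 0, k + 1⟩ = Action.SM2) : p ⟨m', 0, 0, k' + 1⟩ = Action.SM2 := by
  refine h.sm2_mono_queue_of_no_sm1 hcf hum hm ?_
  induction k', hk using Nat.le_induction with
  | base => exact hp
  | succ k' _ ih =>
    cases m with
    | zero => rw [act_empty] at hp; cases hp
    | succ m =>
      exact h.sm2_of_sm2_optimal hcf
        (fun m' hm' => h.sm2_eq
          (h.sm2_mono_queue_of_no_sm1 hcf hum (Nat.succ_le_succ hm') ih))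
        (fun m' _ => h.act_ne_SM1_of_cloud_busy hcf hum _ _)

theorem exists_sm2_of_no_sm1 (h : OptimalityEq a l c1 c2 b p V) (hcf : CloudFirst p)
    (hum : UrgencyMonotone p) (k : ℕ) : ∃ m, p ⟨m, 0, 0, k + 1⟩ = Action.SM2 := by
  obtain ⟨M, hM⟩ := h.exists_sm2 hcf
  refine ⟨M + 1 + 1, h.sm2_mono_of_no_sm1 hcf hum le_rfl (Nat.zero_le k) ?_⟩
  -- With an empty cloud SM1 is prescribed, yet SM2 follows it, so starting with SM2 attains the
  -- same value. Hence `sm2_of_sm2_optimal` assumes equal values, not a prescribed SM2.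
  refine h.sm2_of_sm2_optimal hcf (fun m hm => ?_)
    (fun m _ => h.act_ne_SM1_of_cloud_busy hcf hum _ _)
  obtain ⟨m, rfl⟩ := Nat.exists_eq_succ_of_ne_zero (show m ≠ 0 by omega)
  rw [Nat.succ_eq_add_one, h.sm1_eq (hcf ⟨m + 1 + 1, 0, 0, 0⟩ (Nat.le_add_left 1 _) rfl rfl),
    h.sm1_eq (hcf ⟨m + 1, 1, 0, 0⟩ (Nat.le_add_left 1 _) rfl rfl)]
  exact h.sm2_eq (sm2_mono_queue hum hm hM)

theorem switchType (h : OptimalityEq a l c1 c2 b p V) (hcf : CloudFirst p)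
    (hum : UrgencyMonotone p) : SwitchType p := by
  rintro ⟨m, i2, i1, k⟩ x0 x2 hp
  obtain ⟨hm, hi2⟩ := (show Action.SM2 ∈ admissible ⟨m, i2, i1, k⟩ from hp ▸ p.act_mem _)
  simp only at hm hi2 ⊢
  subst hi2
  rcases fin_two_eq i1 with rfl | rfl
  · cases k with
    | zero => rw [hcf _ hm rfl rfl] at hp; cases hp
    | succ k =>
      rw [Nat.add_right_comm]
      exact h.sm2_mono_of_no_sm1 hcf hum (Nat.le_add_right _ _) (Nat.le_add_right _ _) hp
  · exact h.sm2_mono hcf hum (Nat.le_add_right _ _) (Nat.le_add_right _ _) hp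

end OptimalityEq

theorem exists_threshold {f : ℕ → Action} (hex : ∃ n, f n = Action.SM2)
    (hmono : ∀ m n, m ≤ n → f m = Action.SM2 → f n = Action.SM2)
    (hne : ∀ n, f n ≠ Action.SM1) :
    ∃ N, ∀ n, f n = if N ≤ n then Action.SM2 else Action.idle := by
  classical
  refine ⟨Nat.find hex, fun n => ?_⟩
  split_ifs with h
  · exact hmono _ _ h (Nat.find_spec hex)
  · by_contra h0
    exact h (Nat.find_min' hex (eq_SM2_of_ne h0 (hne n)))

theorem threshold_le {N N' : ℕ} {f g : ℕ → Action}
    (hf : ∀ n, f n = if N ≤ n then Action.SM2 else Action.idle)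
    (hg : ∀ n, g n = if N' ≤ n then Action.SM2 else Action.idle)
    (hfg : ∀ n, f n = Action.SM2 → g n = Action.SM2) : N' ≤ N := by
  by_contra h
  have h1 := hfg N (by rw [hf, if_pos le_rfl])
  rw [hg, if_neg h] at h1
  cases h1

end Offloading

theorem mainTheorem4 (M : Offloading.Params)
    (hstab : M.lam < (M.K + 1) * M.mu0)
    (p : Offloading.Policy)
    (hopt : M.DelayOptimal p)
    (hcf : Offloading.CloudFirst p)
    (humc : Offloading.UrgencyMonotone p) :
    Offloading.SwitchType p ∧
    ∃ N N' : ℕ → ℕ,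
      (∀ j k, j ≤ k → N k ≤ N j) ∧
      (∀ j k, 1 ≤ j → j ≤ k → N' k ≤ N' j) ∧
      (∀ n0 k : ℕ, p ⟨n0, 0, 1, k⟩ =
        if N k ≤ n0 then Offloading.Action.SM2 else Offloading.Action.idle) ∧
      (∀ n0 k : ℕ, 1 ≤ k → p ⟨n0, 0, 0, k⟩ =
        if N' k ≤ n0 then Offloading.Action.SM2 else Offloading.Action.idle) := by
  have h := Offloading.optimalityEq_rcost hopt
  obtain ⟨m0, hm0⟩ := h.exists_sm2 hcf
  have hN : ∀ k, ∃ N, ∀ n, p ⟨n, 0, 1, k⟩ =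
      if N ≤ n then Offloading.Action.SM2 else Offloading.Action.idle := fun k =>
    Offloading.exists_threshold ⟨m0 + 1, h.sm2_mono hcf humc le_rfl (Nat.zero_le k) hm0⟩
      (fun _ _ hm hp => h.sm2_mono hcf humc hm le_rfl hp) fun n => Offloading.act_ne_SM1 p n 0 k
  have hN' : ∀ k, ∃ N, ∀ n, p ⟨n, 0, 0, k + 1⟩ =
      if N ≤ n then Offloading.Action.SM2 else Offloading.Action.idle := fun k =>
    Offloading.exists_threshold (h.exists_sm2_of_no_sm1 hcf humc k)
      (fun _ _ hm hp => h.sm2_mono_of_no_sm1 hcf humc hm le_rfl hp)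
      fun n => h.act_ne_SM1_of_cloud_busy hcf humc n k
  choose N hN using hN
  choose N' hN' using hN'
  -- The chosen `N'` is indexed from one mode 2 job on; truncated subtraction gives index 0 an
  -- irrelevant value.
  refine ⟨h.switchType hcf humc, N, fun k => N' (k - 1), fun j k hjk => ?_, fun j k hj hjk => ?_,
    fun n k => hN k n, fun n k hk => ?_⟩
  · exact Offloading.threshold_le (hN j) (hN k) fun _ hp => h.sm2_mono hcf humc le_rfl hjk hp
  · exact Offloading.threshold_le (hN' (j - 1)) (hN' (k - 1)) fun _ hp =>
      h.sm2_mono_of_no_sm1 hcf humc le_rfl (Nat.sub_le_sub_right hjk 1) hp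
  · obtain ⟨k, rfl⟩ := Nat.exists_eq_succ_of_ne_zero (Nat.one_le_iff_ne_zero.mp hk)
    exact hN' k n
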